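/- **Setting.** Let $\mathcal C,S,A$ be finite sets ($A\neq\emptyset$), $s_0,s_H\in S$ and $H\in\mathbb N$. A dynamics is a map $P(s'\mid s,a)\ge 0$ with $\sum_{s'\in S}P(s'\mid s,a)=1$; it is *layered* if $S$ is a disjoint union of layers $S_0,\dots,S_H$ with $s_0\in S_0$, $S_H=\{s_H\}$, and $P(s'\mid s,a)>0$, $s\in S_h$, $h<H$ imply $s'\in S_{h+1}$. For a deterministic policy $\pi:S\to A$ let $q_h(s\mid\pi,P)$ be the probability that the chain started at $s_0$ and following $\pi$ under $P$ is at $s$ at time $h$, and for $r:S\times A\to\mathbb R$ let $V^{\pi}_{(P,r)}=\mathbb E_{\pi,P}\big[\sum_{h=0}^{H-1}r(s_h,\pi(s_h))\big]$ be its value. A contextual MDP is given by a distribution $\mathcal D$ on $\mathcal C$ and, for each context $c$, a layered dynamics $P_\star^c$ with layers $S^c_0,\dots,S^c_H$ and, for each $(s,a)$, a reward law on $[0,1]$ with mean $r_\star^c(s,a)$. Assume minimum reachability with a known $p_{\min}\in(0,1]$: $q_h(s\mid\pi,P_\star^c)\ge p_{\min}$ for all $c$, all $h$, all $s\in S^c_h$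 and all $\pi:S\to A$. Let $\mathcal F$ be a finite class of functions $\mathcal C\times S\times A\to[0,1]$ containing $(c,s,a)\mapsto r_\star^c(s,a)$, and let $\mathcal P$ be a finite class of context-dependent dynamics $P=(P^c)_{c\in\mathcal C}$, each $P^c$ layered (possibly with layers of its own, but with the same $s_0$, $s_H$, $H$), containing $P_\star$. **Algorithm RM-UCDD.** Let $\delta\in(0,1)$ and $\beta_t=\sqrt{\frac{17t\log(8|\mathcal F|t^3/\delta)}{|S||A|}}$, $\gamma_t=\sqrt{\frac{18t\log(8|\mathcal P|t^3/\delta)}{|S||A|}}$. In each round $t$ the algorithm selects a context-dependent policy $\pi_t(c;\cdot):S\to A$; then $c_t\sim\mathcal D$ is drawn, independently of the past, and an episode $s^t_0,a^t_0,r^t_0,\dots,s^t_H$ of $\pi_t(c_t;\cdot)$ is observed, where $s^t_0=s_0$, $a^t_h=\pi_t(c_t;s^t_h)$, $s^t_{h+1}\sim P_\star^{c_t}(\cdot\mid s^t_h,a^t_h)$ and $r^t_h$ is drawn from the reward law of $(c_t,s^t_h,a^t_h)$. In round $t\le|A|$, $\pi_t$ always plays the $t$-th action. In round $t>|A|$,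 least-squares oracles return $$\hat f_t\in\arg\min_{f\in\mathcal F}\sum_{i<t}\sum_{h<H}\big(f(c_i,s^i_h,a^i_h)-r^i_h\big)^2,\qquad \hat P_t\in\arg\min_{P\in\mathcal P}\sum_{i<t}\sum_{h<H}\sum_{s'\in S}\big(P^{c_i}(s'\mid s^i_h,a^i_h)-\mathbb 1[s'=s^i_{h+1}]\big)^2,$$ and $\pi_t(c;\cdot)\in\arg\max_{\pi:S\to A}V^\pi_{(\hat P_t^c,\hat r_t^c)}$ is computed by a planning algorithm, where $$\hat r^c_t(s,a)=\hat f_t(c,s,a)+\frac{\beta_t+H|S|\gamma_t}{p_{\min}\,\#\{i<t:\pi_i(c;s)=a\}}.$$ **Theorem.** Let $\pi^\star(c;\cdot)\in\arg\max_{\pi} V^{\pi}_{(P_\star^c,r_\star^c)}$ for every $c$, let $\mathrm{Regret}_T=\sum_{t=1}^T\big(V^{\pi^\star(c_t;\cdot)}_{(P_\star^{c_t},r_\star^{c_t})}-V^{\pi_t(c_t;\cdot)}_{(P_\star^{c_t},r_\star^{c_t})}\big)$, and write $\log_+x=\max\{1,\log x\}$. There are absolute constants $K>0$ and $k\in\mathbb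 N$ such that in the above setting, for every $T\ge1$, with probability at least $1-\delta$, $$\mathrm{Regret}_T\le K(1+\log T)^k\Big[\Big(H+\tfrac1{p_{\min}}\Big)\Big(H|S|^{3/2}\sqrt{|A|T\log_+\tfrac{|\mathcal P|}{\delta}}+\sqrt{T|S||A|\log_+\tfrac{|\mathcal F|}{\delta}}\Big)+|A|H\Big].$$ If moreover $\mathcal F=\mathcal G^S$ for a finite class $\mathcal G$ of functions $\mathcal C\times A\to[0,1]$, that is, $\mathcal F$ consists of all $f$ with $f(\cdot,s,\cdot)\in\mathcal G$ for every $s\in S$, then with probability at least $1-\delta$, $$\mathrm{Regret}_T\le K(1+\log T)^k\Big[\Big(H+\tfrac1{p_{\min}}\Big)\Big(H|S|^{3/2}\sqrt{T|A|\log_+\tfrac{|\mathcal P|}{\delta}}+|S|\sqrt{T|A|\log_+\tfrac{|\mathcal G|}{\delta}}\Big)+|A|H\Big],$$ and also with probability at least $1-\delta$, $$\mathrm{Regret}_T\le K(1+\log T)^k\Big(H+\tfrac1{p_{\min}}\Big)H|S|^{3/2}\sqrt{|A|T\log_+\tfrac{\max\{|\mathcal G|,|\mathcal P|\}}{\delta}}.$$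 -/

import Mathlib

open MeasureTheory

noncomputable section

namespace UCDD

/-- An observed episode: the context, the visited states `s_0, …, s_H`, the played actions
`a_0, …, a_{H-1}` and the observed rewards `r_0, …, r_{H-1}`. -/
abbrev Traj (C S A : Type*) (H : ℕ) : Type _ :=
  C × (Fin (H + 1) → S) × (Fin H → A) × (Fin H → ℝ)

/-- `P s a s'` is the probability of moving to `s'` when `a` is played in `s`. -/
def IsTransition {S A : Type*} [Fintype S] (P : S → A → S → ℝ) : Prop :=
  (∀ s a s', 0 ≤ P s a s') ∧ ∀ s a, ∑ s', P s a s' = 1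

/-- `layer` decomposes the states into layers `0, …, H`: the start state is in layer `0`, the final
layer consists of `sH` alone, and from a state before the final layer one moves only to the next
layer. -/
def IsLayering {S A : Type*} {H : ℕ} (s0 sH : S) (P : S → A → S → ℝ)
    (layer : S → Fin (H + 1)) : Prop :=
  layer s0 = 0 ∧ (∀ s, layer s = Fin.last H ↔ s = sH) ∧
    ∀ s a s', s ≠ sH → P s a s' ≠ 0 → (layer s' : ℕ) = layer s + 1

/-- Probability of the state sequence `x` when the deterministic policy `π` is played from `s0`
under the dynamics `P`. -/
def pathProb {S A : Type*} [DecidableEq S] {H : ℕ} (s0 : S) (P : S → A → S → ℝ) (π : S → A)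
    (x : Fin (H + 1) → S) : ℝ :=
  (if x 0 = s0 then 1 else 0) *
    ∏ h : Fin H, P (x h.castSucc) (π (x h.castSucc)) (x h.succ)

/-- Occupancy measure `q_h(s | π, P)`: the probability of being in `s` at time `h`. -/
def occupancy {S A : Type*} [Fintype S] [DecidableEq S] {H : ℕ} (s0 : S) (P : S → A → S → ℝ)
    (π : S → A) (h : Fin (H + 1)) (s : S) : ℝ :=
  ∑ x : Fin (H + 1) → S, if x h = s then pathProb s0 P π x else 0

/-- The value `V^π_M(s_0)` of the MDP `M = (S, A, P, r, s_0, H)`: the expected sum of the rewards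
`r(s_h, π(s_h))` over `h = 0, …, H - 1`. -/
def value {S A : Type*} [Fintype S] [DecidableEq S] (H : ℕ) (s0 : S) (P : S → A → S → ℝ)
    (r : S → A → ℝ) (π : S → A) : ℝ :=
  ∑ x : Fin (H + 1) → S,
    pathProb s0 P π x * ∑ h : Fin H, r (x h.castSucc) (π (x h.castSucc))

/-- A layered contextual MDP with finite horizon `H` and context-dependent dynamics and rewards. -/
structure CMDP (C S A : Type*) [Fintype S] (H : ℕ) where
  /-- distribution of the contexts -/
  ctx : PMF C
  /-- start state -/
  s0 : S
  /-- final state -/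
  sH : S
  /-- true dynamics -/
  dyn : C → S → A → S → ℝ
  /-- layer of a state, for each context -/
  layer : C → S → Fin (H + 1)
  /-- law of the random reward of an action in a state -/
  rew : C → S → A → Measure ℝ
  isTransition : ∀ c, IsTransition (dyn c)
  isLayering : ∀ c, IsLayering s0 sH (dyn c) (layer c)
  isProb_rew : ∀ c s a, IsProbabilityMeasure (rew c s a)
  rew_mem : ∀ c s a, ∀ᵐ x ∂(rew c s a), x ∈ Set.Icc (0 : ℝ) 1

namespace CMDP

variable {C S A : Type*} [Fintype S] {H : ℕ}

/-- Expected reward. -/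
def meanRew (M : CMDP C S A H) (c : C) (s : S) (a : A) : ℝ := ∫ x, x ∂(M.rew c s a)

/-- Value of the policy `π` in the MDP of the context `c`. -/
def val [DecidableEq S] (M : CMDP C S A H) (c : C) (π : S → A) : ℝ :=
  value H M.s0 (M.dyn c) (M.meanRew c) π

/-- Under every deterministic policy, every state is visited with probability at least `pmin`
at the time of its layer. -/
def MinReach [DecidableEq S] (M : CMDP C S A H) (pmin : ℝ) : Prop :=
  ∀ (c : C) (π : S → A) (s : S), pmin ≤ occupancy M.s0 (M.dyn c) π (M.layer c s) s

/-- A deterministic context-dependent policy that is optimal for every context. -/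
def IsOptimal [DecidableEq S] (M : CMDP C S A H) (πs : C → S → A) : Prop :=
  ∀ (c : C) (π : S → A), M.val c π ≤ M.val c (πs c)

/-- Law of an episode in which the context-dependent policy `π` is played: the context is drawn
from the context distribution, the states follow the dynamics of this context, and, given these,
the rewards are drawn independently from the reward laws of the visited state-action pairs. -/
def episodeLaw [Fintype C] [DecidableEq S] [MeasurableSpace C] [MeasurableSpace S]
    [MeasurableSpace A] (M : CMDP C S A H) (π : C → S → A) : Measure (Traj C S A H) :=
  ∑ c : C, ∑ x : Fin (H + 1) → S,
    (M.ctx c * ENNReal.ofReal (pathProb M.s0 (M.dyn c) (π c) x)) •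
      (Measure.pi fun h : Fin H => M.rew c (x h.castSucc) (π c (x h.castSucc))).map
        fun r => (c, x, (fun h => π c (x h.castSucc)), r)

end CMDP

/-- Least-squares objective for the rewards on `n` observed episodes. -/
def rewLoss {C S A : Type*} {H n : ℕ} (f : C → S → A → ℝ) (σ : Fin n → Traj C S A H) : ℝ :=
  ∑ i, ∑ h : Fin H,
    (f (σ i).1 ((σ i).2.1 h.castSucc) ((σ i).2.2.1 h) - (σ i).2.2.2 h) ^ 2

/-- Least-squares objective for the dynamics on `n` observed episodes. -/
def dynLoss {C S A : Type*} [Fintype S] [DecidableEq S] {H n : ℕ} (P : C → S → A → S → ℝ)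
    (σ : Fin n → Traj C S A H) : ℝ :=
  ∑ i, ∑ h : Fin H, ∑ s' : S,
    (P (σ i).1 ((σ i).2.1 h.castSucc) ((σ i).2.2.1 h) s'
      - if s' = (σ i).2.1 h.succ then 1 else 0) ^ 2

/-- Least-squares regression oracle for the reward class `F`: from the observed episodes it
computes (measurably) a minimizer over `F` of the least-squares objective. -/
def IsRewOracle {C S A : Type*} [MeasurableSpace C] [MeasurableSpace S] [MeasurableSpace A] {H : ℕ}
    (F : Finset (C → S → A → ℝ))
    (o : (n : ℕ) → (Fin n → Traj C S A H) → C → S → A → ℝ) : Prop :=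
  ∀ n, Measurable (o n) ∧ ∀ σ, o n σ ∈ F ∧ ∀ f ∈ F, rewLoss (o n σ) σ ≤ rewLoss f σ

/-- Least-squares regression oracle for the dynamics class `Fp`. -/
def IsDynOracle {C S A : Type*} [Fintype S] [DecidableEq S] [MeasurableSpace C]
    [MeasurableSpace S] [MeasurableSpace A] {H : ℕ} (Fp : Finset (C → S → A → S → ℝ))
    (o : (n : ℕ) → (Fin n → Traj C S A H) → C → S → A → S → ℝ) : Prop :=
  ∀ n, Measurable (o n) ∧ ∀ σ, o n σ ∈ Fp ∧ ∀ P ∈ Fp, dynLoss (o n σ) σ ≤ dynLoss P σ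

/-- Planning: from the dynamics and the rewards of an MDP, compute an optimal policy. -/
def IsPlanner {S A : Type*} [Fintype S] [DecidableEq S] (H : ℕ) (s0 : S)
    (plan : (S → A → S → ℝ) → (S → A → ℝ) → S → A) : Prop :=
  ∀ P r π, value H s0 P r π ≤ value H s0 P r (plan P r)

/-- What algorithm RM-UCDD works with: an enumeration `a_1, …, a_{|A|}` of the actions, the two
regression oracles, the planning algorithm, the reachability parameter and the tuning parameters
(indexed by the rounds `t = 1, 2, …`). -/
structure Alg (C S A : Type*) [Fintype A] (H : ℕ) where
  enum : Fin (Fintype.card A) ≃ A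
  rewOracle : (n : ℕ) → (Fin n → Traj C S A H) → C → S → A → ℝ
  dynOracle : (n : ℕ) → (Fin n → Traj C S A H) → C → S → A → S → ℝ
  plan : (S → A → S → ℝ) → (S → A → ℝ) → S → A
  pmin : ℝ
  β : ℕ → ℝ
  γ : ℕ → ℝ

namespace Alg

variable {C S A : Type*} [Fintype S] [Fintype A] [DecidableEq A] {H : ℕ}

/-- The policies `π_1(c; ·), π_2(c; ·), …` that the algorithm computes for the context `c` from the
sequences of the regression estimates. The index `n` stands for round `t = n + 1`. In the first
`|A|` rounds one action is played everywhere; later the planner is run on the estimated dynamics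
and on the estimated rewards increased by
`(β_t + H |S| γ_t) / (pmin * #{i < t | π_i(c; s) = a})`. -/
def policySeq (𝒜 : Alg C S A H) (fhat : ℕ → C → S → A → ℝ) (Phat : ℕ → C → S → A → S → ℝ)
    (c : C) (n : ℕ) : S → A :=
  if hn : n < Fintype.card A then fun _ => 𝒜.enum ⟨n, hn⟩
  else
    𝒜.plan (Phat n c) fun s a =>
      fhat n c s a +
        (𝒜.β (n + 1) + H * Fintype.card S * 𝒜.γ (n + 1)) /
          (𝒜.pmin * ∑ i : Fin n, if a = 𝒜.policySeq fhat Phat c i s then (1 : ℝ) else 0)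
termination_by n
decreasing_by exact i.2

/-- The context-dependent policy of round `n + 1`, given the `n` episodes observed before. The
estimates of round `i + 1` are computed from the first `i` episodes. -/
def policy (𝒜 : Alg C S A H) {n : ℕ} (σ : Fin n → Traj C S A H) : C → S → A := fun c =>
  𝒜.policySeq
    (fun i => if hi : i ≤ n then 𝒜.rewOracle i (fun j => σ (Fin.castLE hi j)) else 0)
    (fun i => if hi : i ≤ n then 𝒜.dynOracle i (fun j => σ (Fin.castLE hi j)) else 0)
    c n

variable [Fintype C] [DecidableEq S] [MeasurableSpace C] [MeasurableSpace S] [MeasurableSpace A]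

/-- Joint law of the first `n` episodes when the algorithm interacts with the contextual MDP `M`:
given the episodes observed so far, the next one is drawn from the episode law of the policy
selected by the algorithm. -/
def historyLaw (𝒜 : Alg C S A H) (M : CMDP C S A H) : (n : ℕ) → Measure (Fin n → Traj C S A H)
  | 0 => Measure.dirac Fin.elim0
  | n + 1 => (𝒜.historyLaw M n).bind fun σ =>
      (M.episodeLaw (𝒜.policy σ)).map fun τ => Fin.snoc (α := fun _ => Traj C S A H) σ τ

/-- Regret over `T` rounds with respect to `πs`. -/
def regret (𝒜 : Alg C S A H) (M : CMDP C S A H) (πs : C → S → A) {T : ℕ}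
    (σ : Fin T → Traj C S A H) : ℝ :=
  ∑ t : Fin T,
    (M.val (σ t).1 (πs (σ t).1)
      - M.val (σ t).1 (𝒜.policy (fun j : Fin t => σ (Fin.castLE t.2.le j)) (σ t).1))

end Alg

/-- `β_t = sqrt (17 t log (8 |F| t³ / δ) / (|S| |A|))`, for `nF = |F|` and so on. -/
def betaParam (nF nS nA : ℕ) (δ : ℝ) (t : ℕ) : ℝ :=
  √(17 * t * Real.log (8 * nF * (t : ℝ) ^ 3 / δ) / (nS * nA))

/-- `γ_t = sqrt (18 t log (8 |Fp| t³ / δ) / (|S| |A|))`. -/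
def gammaParam (nP nS nA : ℕ) (δ : ℝ) (t : ℕ) : ℝ :=
  √(18 * t * Real.log (8 * nP * (t : ℝ) ^ 3 / δ) / (nS * nA))

/-- The logarithmic factor `log x`, read as at least `1`. -/
def logp (x : ℝ) : ℝ := max 1 (Real.log x)

end UCDD

end

/-! The analysis needs neither confidence sets nor exact optimism. Fix a round after the first
`|A|`, a context `c`, and let `x(s,a)` be `pmin` times the number of earlier policies that choose
`a` in `(c,s)`. By AM-GM, a reward error `d` satisfies `|d| ≤ β/x + x d²/(4β)`. Together with
Cauchy-Schwarz, the same argument bounds the `ℓ¹` error of a transition law by `|S|γ/x` plus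
`x/(4γ)` times its squared `ℓ²` error. The first terms add up to exactly the bonus. The second,
summed over states along any policy, are at most the expected squared errors accumulated in context
`c` by the earlier policies, because by minimum reachability each of them visits each state with
probability at least `pmin`.

The simulation lemma is applied in the estimated dynamics, where layering bounds a value by a sum
over states. The estimated value is therefore optimistic up to these squared errors, and
overestimates the value of the chosen policy by at most two bonuses plus the same errors
(`Alg.regret_round_le`). This step is deterministic and holds for every context, not only the drawn
one.

Averaging over contexts leaves two sums over rounds. The counts refer to policies rather than
observed visits, so for each fixed `(c,s)` the inverse counts sum to at most `|A|(1 + log T)`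
(`sum_inv_count_le`). The accumulated expected squared errors of the least-squares estimates are
`O(H log(T|F|/δ))` and `O(H log(T|Fp|/δ))`: the excess loss has second moment controlled by its
mean, which gives exponential supermartingales (`CMDP.lintegral_exp_rewGap_le`,
`CMDP.lintegral_exp_dynGap_le`), and a minimizer has nonpositive excess loss. Dividing by `β_t`,
`γ_t`, of order `√(t log / (|S||A|))`, balances both contributions at `√(T|S||A| log)`, up to
factors `H`, `|S|`, `1/pmin` and `log T`.

Finally, the realized regret is at most twice the sum of its conditional means plus `H log(3/δ)`, by
one more supermartingale. The union bound over all supermartingales is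
`Alg.le_historyLaw_concentration`. -/

noncomputable section

namespace UCDD

open ProbabilityTheory

/-! ### Path probabilities, the simulation lemma, layering and reachability -/

section Paths

theorem abs_sum_sub_mul_le {S : Type*} [Fintype S] {P Q u : S → ℝ} {B : ℝ}
    (h0 : ∀ s, 0 ≤ u s) (h1 : ∀ s, u s ≤ B) :
    |∑ s, (P s - Q s) * u s| ≤ B * ∑ s, |P s - Q s| := by
  refine (Finset.abs_sum_le_sum_abs _ _).trans ?_
  rw [Finset.mul_sum]
  refine Finset.sum_le_sum fun s _ => ?_
  rw [abs_mul, abs_of_nonneg (h0 s), mul_comm]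
  exact mul_le_mul_of_nonneg_right (h1 s) (abs_nonneg _)

/-- Induction on time: before time `H` the path cannot be at `sH`, which lies only in the last
layer, so each positive-probability step raises the layer by one. -/
theorem layer_eq_of_pathProb_ne_zero {S A : Type*} [DecidableEq S] {H : ℕ}
    {s0 sH : S} {P : S → A → S → ℝ} {layer : S → Fin (H + 1)}
    (hl : IsLayering s0 sH P layer) {π : S → A} {x : Fin (H + 1) → S}
    (hx : pathProb s0 P π x ≠ 0) (h : Fin (H + 1)) : layer (x h) = h := by
  have hx0 : x 0 = s0 := by
    by_contra hne
    simp [pathProb, hne] at hx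
  have hstep : ∀ h : Fin H, P (x h.castSucc) (π (x h.castSucc)) (x h.succ) ≠ 0 := by
    intro h hne
    exact hx (by rw [pathProb, Finset.prod_eq_zero (Finset.mem_univ h) hne, mul_zero])
  induction h using Fin.induction with
  | zero => rw [hx0, hl.1]
  | succ h ih =>
    have hne : x h.castSucc ≠ sH := by
      intro he
      have := (hl.2.1 _).2 he
      rw [ih] at this
      exact (Fin.castSucc_lt_last h).ne this
    have := hl.2.2 _ _ _ hne (hstep h)
    rw [ih] at this
    ext
    simpa using this

variable {S A : Type*} [Fintype S] [DecidableEq S]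

/-- First-step decomposition; every recursion for values rests on it. The indicator in `pathProb s'
P π y` collapses the sum over `s'` to `s' = y 0`. -/
theorem sum_pathProb_succ {k : ℕ} (s : S) (P : S → A → S → ℝ) (π : S → A)
    (φ : (Fin (k + 1 + 1) → S) → ℝ) :
    ∑ x : Fin (k + 1 + 1) → S, pathProb s P π x * φ x =
      ∑ s', P s (π s) s' * ∑ y : Fin (k + 1) → S,
        pathProb s' P π y * φ (Fin.cons (α := fun _ => S) s y) := by
  rw [← (Fin.consEquiv (fun _ : Fin (k + 1 + 1) => S)).sum_comp, Fintype.sum_prod_type,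
    Finset.sum_eq_single s]
  · simp_rw [Finset.mul_sum]
    rw [Finset.sum_comm]
    refine Finset.sum_congr rfl fun y _ => ?_
    rw [Finset.sum_eq_single (y 0)]
    · simp only [pathProb, Fin.consEquiv_apply, Fin.cons_zero, if_true, one_mul,
        Fin.prod_univ_succ, Fin.castSucc_zero, Fin.cons_succ, Fin.castSucc_succ, mul_assoc]
      rfl
    · intro b _ hb
      simp [pathProb, hb.symm]
    · simp
  · intro b _ hb
    simp [pathProb, hb]
  · simp

theorem sum_pathProb_zero (s : S) (P : S → A → S → ℝ) (π : S → A) (φ : (Fin (0 + 1) → S) → ℝ) :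
    ∑ x : Fin (0 + 1) → S, pathProb s P π x * φ x = φ fun _ => s := by
  rw [Finset.sum_eq_single fun _ => s]
  · simp [pathProb]
  · intro x _ hx
    have : x 0 ≠ s := fun h => hx (by ext i; rw [Fin.fin_one_eq_zero i, h])
    simp [pathProb, this]
  · simp

theorem pathProb_nonneg {H : ℕ} (s : S) {P : S → A → S → ℝ} (hP : IsTransition P) (π : S → A)
    (x : Fin (H + 1) → S) : 0 ≤ pathProb s P π x := by
  unfold pathProb
  refine mul_nonneg (by split_ifs <;> norm_num) (Finset.prod_nonneg fun h _ => hP.1 _ _ _)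

theorem sum_pathProb (H : ℕ) (s : S) {P : S → A → S → ℝ} (hP : IsTransition P) (π : S → A) :
    ∑ x : Fin (H + 1) → S, pathProb s P π x = 1 := by
  induction H generalizing s with
  | zero => simpa using sum_pathProb_zero s P π fun _ => 1
  | succ k ih =>
    have := sum_pathProb_succ (k := k) s P π fun _ => 1
    simp only [mul_one] at this
    rw [this]
    simp [ih, hP.2]

theorem value_zero (s : S) (P : S → A → S → ℝ) (r : S → A → ℝ) (π : S → A) :
    value 0 s P r π = 0 := by
  simp [value]

theorem value_succ (k : ℕ) (s : S) {P : S → A → S → ℝ} (hP : IsTransition P) (r : S → A → ℝ)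
    (π : S → A) :
    value (k + 1) s P r π = r s (π s) + ∑ s', P s (π s) s' * value k s' P r π := by
  unfold value
  rw [sum_pathProb_succ]
  simp only [Fin.sum_univ_succ, Fin.castSucc_zero, Fin.cons_zero, Fin.cons_succ, mul_add,
    Finset.sum_add_distrib, Fin.castSucc_succ]
  congr 1
  simp_rw [← Finset.sum_mul, sum_pathProb k _ hP, one_mul, ← Finset.sum_mul, hP.2, one_mul]

theorem sum_pathProb_mul_zero (k : ℕ) (s : S) {P : S → A → S → ℝ} (hP : IsTransition P)
    (π : S → A) (u : S → ℝ) :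
    ∑ x : Fin (k + 1) → S, pathProb s P π x * u (x 0) = u s := by
  rw [← one_mul (u s), ← sum_pathProb k s hP π, Finset.sum_mul]
  refine Finset.sum_congr rfl fun x _ => ?_
  by_cases hx : x 0 = s
  · rw [hx]
  · simp [pathProb, hx]

/-- Expectation of a sum over the transitions of a path. -/
theorem sum_pathProb_mul_sum_transition {k : ℕ} (s : S) {P : S → A → S → ℝ}
    (hP : IsTransition P) (π : S → A) (φ : S → S → ℝ) :
    ∑ x : Fin (k + 1) → S, pathProb s P π x * ∑ h : Fin k, φ (x h.castSucc) (x h.succ) =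
      value k s P (fun s _ => ∑ s', P s (π s) s' * φ s s') π := by
  induction k generalizing s with
  | zero => simp [value]
  | succ k ih =>
    rw [sum_pathProb_succ, value_succ k s hP]
    simp only [Fin.sum_univ_succ, Fin.castSucc_zero, Fin.cons_zero, Fin.cons_succ, mul_add,
      Finset.sum_add_distrib, Fin.castSucc_succ]
    congr 1
    · exact Finset.sum_congr rfl fun s' _ => by rw [sum_pathProb_mul_zero k s' hP π (φ s)]
    · exact Finset.sum_congr rfl fun s' _ => by rw [← ih]

theorem value_nonneg (k : ℕ) (s : S) {P : S → A → S → ℝ} (hP : IsTransition P) {r : S → A → ℝ}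
    (hr : ∀ s a, 0 ≤ r s a) (π : S → A) : 0 ≤ value k s P r π :=
  Finset.sum_nonneg fun x _ => mul_nonneg (pathProb_nonneg s hP π x)
    (Finset.sum_nonneg fun _ _ => hr _ _)

theorem value_le (k : ℕ) (s : S) {P : S → A → S → ℝ} (hP : IsTransition P) {r : S → A → ℝ}
    (hr : ∀ s a, r s a ≤ 1) (π : S → A) : value k s P r π ≤ k := by
  calc value k s P r π ≤ ∑ x : Fin (k + 1) → S, pathProb s P π x * k := by
        refine Finset.sum_le_sum fun x _ => mul_le_mul_of_nonneg_left ?_ (pathProb_nonneg s hP π x)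
        exact (Finset.sum_le_sum fun _ _ => hr _ _).trans (by simp)
    _ = k := by rw [← Finset.sum_mul, sum_pathProb k s hP, one_mul]

/-- Simulation lemma: the gap between the values of two MDPs is at most the value, in the
first dynamics, of the pointwise errors. -/
theorem value_sub_value_le {H : ℕ} (k : ℕ) (hk : k ≤ H) (s : S) {P Q : S → A → S → ℝ}
    (hP : IsTransition P) (hQ : IsTransition Q) {r q : S → A → ℝ}
    (h0 : ∀ s a, 0 ≤ q s a) (h1 : ∀ s a, q s a ≤ 1) (π : S → A) :
    value k s P r π - value k s Q q π ≤
      value k s P (fun s a => r s a - q s a + H * ∑ s', |P s a s' - Q s a s'|) π := by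
  induction k generalizing s with
  | zero => simp [value_zero]
  | succ k ih =>
    rw [value_succ k s hP, value_succ k s hQ, value_succ k s hP]
    have h2 := Finset.sum_le_sum fun s' (_ : s' ∈ Finset.univ) =>
      mul_le_mul_of_nonneg_left (ih (by omega) s') (hP.1 s (π s) s')
    -- Replacing one transition law by the other costs their `ℓ¹` distance times a bound for the
    -- remaining value in `(Q, q)`, which is at most `k ≤ H`.
    have h3 := (le_abs_self _).trans (abs_sum_sub_mul_le (P := P s (π s)) (Q := Q s (π s))
      (u := fun s' => value k s' Q q π) (B := H) (fun s' => value_nonneg k s' hQ h0 π)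
      (fun s' => (value_le k s' hQ h1 π).trans (by exact_mod_cast (by omega : k ≤ H))))
    simp only [mul_sub, sub_mul, Finset.sum_sub_distrib] at h2 h3
    linarith

/-- The opposite direction, with the errors still evaluated in `P`. Only `q` must lie in `[0,1]`, so
`r` may carry an unbounded bonus: in the application `P`, `r` are the estimates and `Q`, `q` the
truth. -/
theorem value_sub_value_ge {H : ℕ} (k : ℕ) (hk : k ≤ H) (s : S) {P Q : S → A → S → ℝ}
    (hP : IsTransition P) (hQ : IsTransition Q) {r q : S → A → ℝ}
    (h0 : ∀ s a, 0 ≤ q s a) (h1 : ∀ s a, q s a ≤ 1) (π : S → A) :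
    value k s Q q π - value k s P r π ≤
      value k s P (fun s a => q s a - r s a + H * ∑ s', |P s a s' - Q s a s'|) π := by
  induction k generalizing s with
  | zero => simp [value_zero]
  | succ k ih =>
    rw [value_succ k s hP, value_succ k s hQ, value_succ k s hP]
    have h2 := Finset.sum_le_sum fun s' (_ : s' ∈ Finset.univ) =>
      mul_le_mul_of_nonneg_left (ih (by omega) s') (hP.1 s (π s) s')
    have h3 := (neg_abs_le _).trans' (neg_le_neg (abs_sum_sub_mul_le
      (P := P s (π s)) (Q := Q s (π s))
      (u := fun s' => value k s' Q q π) (B := H) (fun s' => value_nonneg k s' hQ h0 π)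
      (fun s' => (value_le k s' hQ h1 π).trans (by exact_mod_cast (by omega : k ≤ H)))))
    simp only [mul_sub, sub_mul, Finset.sum_sub_distrib] at h2 h3
    linarith

/-- In a layered MDP every state other than the final one is visited at most once. -/
theorem value_le_sum {H : ℕ} {s0 sH : S} {P : S → A → S → ℝ} (hP : IsTransition P)
    {layer : S → Fin (H + 1)} (hl : IsLayering s0 sH P layer) {r : S → A → ℝ} {π : S → A}
    {G : S → ℝ} (hG : ∀ s, 0 ≤ G s) (hr : ∀ s, s ≠ sH → r s (π s) ≤ G s) :
    value H s0 P r π ≤ ∑ s ∈ Finset.univ.erase sH, G s := by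
  have key : ∀ x : Fin (H + 1) → S, pathProb s0 P π x * ∑ h : Fin H, r (x h.castSucc)
      (π (x h.castSucc)) ≤ pathProb s0 P π x * ∑ s ∈ Finset.univ.erase sH, G s := by
    intro x
    by_cases hx : pathProb s0 P π x = 0
    · simp [hx]
    refine mul_le_mul_of_nonneg_left ?_ (pathProb_nonneg s0 hP π x)
    have hlay := layer_eq_of_pathProb_ne_zero hl hx
    have hne : ∀ h : Fin H, x h.castSucc ≠ sH := by
      intro h he
      have := (hl.2.1 _).2 he
      rw [hlay] at this
      exact (Fin.castSucc_lt_last h).ne this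
    -- Different times lie in different layers, so no state repeats.
    have hinj : Function.Injective fun h : Fin H => x h.castSucc := by
      intro a b hab
      have := congrArg layer hab
      simp only [hlay] at this
      exact Fin.castSucc_injective _ this
    calc ∑ h : Fin H, r (x h.castSucc) (π (x h.castSucc))
        ≤ ∑ h : Fin H, G (x h.castSucc) := Finset.sum_le_sum fun h _ => hr _ (hne h)
      _ = ∑ s ∈ Finset.univ.image fun h : Fin H => x h.castSucc, G s :=
          (Finset.sum_image fun a _ b _ hab => hinj hab).symm
      _ ≤ ∑ s ∈ Finset.univ.erase sH, G s := by
          refine Finset.sum_le_sum_of_subset_of_nonneg ?_ fun s _ _ => hG s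
          intro s hs
          obtain ⟨h, -, rfl⟩ := Finset.mem_image.1 hs
          exact Finset.mem_erase.2 ⟨hne h, Finset.mem_univ _⟩
  refine (Finset.sum_le_sum fun x _ => key x).trans ?_
  rw [← Finset.sum_mul, sum_pathProb H s0 hP, one_mul]

/-- Minimum reachability bounds a value from below by the sum of the rewards of all states. -/
theorem mul_sum_le_value {H : ℕ} {s0 sH : S} {P : S → A → S → ℝ} (hP : IsTransition P)
    {layer : S → Fin (H + 1)} (hl : IsLayering s0 sH P layer) {r : S → A → ℝ} {π : S → A}
    (hr : ∀ s a, 0 ≤ r s a) {p : ℝ} (hp : ∀ s, p ≤ occupancy s0 P π (layer s) s) :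
    p * ∑ s ∈ Finset.univ.erase sH, r s (π s) ≤ value H s0 P r π := by
  calc p * ∑ s ∈ Finset.univ.erase sH, r s (π s)
      ≤ ∑ s ∈ Finset.univ.erase sH, occupancy s0 P π (layer s) s * r s (π s) := by
        rw [Finset.mul_sum]
        exact Finset.sum_le_sum fun s _ => mul_le_mul_of_nonneg_right (hp s) (hr _ _)
    _ = ∑ x : Fin (H + 1) → S, pathProb s0 P π x *
          ∑ s ∈ Finset.univ.erase sH, if x (layer s) = s then r s (π s) else 0 := by
        simp_rw [occupancy, Finset.sum_mul, Finset.mul_sum]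
        rw [Finset.sum_comm]
        refine Finset.sum_congr rfl fun x _ => Finset.sum_congr rfl fun s _ => ?_
        split_ifs <;> simp
    _ ≤ value H s0 P r π := by
        refine Finset.sum_le_sum fun x _ =>
          mul_le_mul_of_nonneg_left ?_ (pathProb_nonneg s0 hP π x)
        rw [← Finset.sum_filter]
        have hlt : ∀ s, s ≠ sH → layer s ≠ Fin.last H := fun s hs he => hs ((hl.2.1 s).1 he)
        -- A non-final state found at the time of its layer is among the states that collect a
        -- reward on this path.
        have hsub : (Finset.univ.erase sH).filter (fun s => x (layer s) = s) ⊆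
            Finset.univ.image fun h : Fin H => x h.castSucc := by
          intro s hs
          simp only [Finset.mem_filter, Finset.mem_erase, Finset.mem_univ, and_true] at hs
          refine Finset.mem_image.2 ⟨(layer s).castPred (hlt s hs.1), Finset.mem_univ _, ?_⟩
          simpa using hs.2
        refine (Finset.sum_le_sum_of_subset_of_nonneg hsub fun s _ _ => hr _ _).trans ?_
        exact Finset.sum_image_le_of_nonneg fun _ _ => hr _ _

end Paths

/-! ### Context weights -/

section Context

variable {C S A : Type*} [Fintype S] {H : ℕ}

/-- Probability of a context, as a real number. -/
def CMDP.wt (M : CMDP C S A H) (c : C) : ℝ := (M.ctx c).toReal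

theorem CMDP.wt_nonneg (M : CMDP C S A H) (c : C) : 0 ≤ M.wt c := ENNReal.toReal_nonneg

theorem CMDP.sum_wt [Fintype C] (M : CMDP C S A H) : ∑ c, M.wt c = 1 := by
  have h := M.ctx.tsum_coe
  rw [tsum_fintype] at h
  simp only [CMDP.wt]
  rw [← ENNReal.toReal_sum fun c _ => M.ctx.apply_ne_top c, h, ENNReal.toReal_one]

end Context

/-! ### Measurability of appending an episode -/

section Snoc

theorem measurable_snoc {E : Type*} [MeasurableSpace E] (n : ℕ) :
    Measurable fun p : (Fin n → E) × E =>
    (Fin.snoc (α := fun _ => E) p.1 p.2 : Fin (n + 1) → E) := by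
  refine measurable_pi_lambda _ fun i => ?_
  induction i using Fin.lastCases with
  | last => simpa using measurable_snd
  | cast i =>
    simp only [Fin.snoc_castSucc]
    fun_prop

end Snoc

/-! ### Integration against the law of one episode -/

section EpisodeLaw

variable {C S A : Type*} [Fintype C] [Fintype S] [DecidableEq S]
  [MeasurableSpace C] [MeasurableSpace S] [MeasurableSpace A] {H : ℕ}

theorem CMDP.lintegral_episodeLaw (M : CMDP C S A H) (π : C → S → A)
    {φ : Traj C S A H → ENNReal} (hφ : Measurable φ) :
    ∫⁻ τ, φ τ ∂(M.episodeLaw π) =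
      ∑ c : C, ∑ x : Fin (H + 1) → S,
        (M.ctx c * ENNReal.ofReal (pathProb M.s0 (M.dyn c) (π c) x)) *
          ∫⁻ r, φ (c, x, (fun h => π c (x h.castSucc)), r)
            ∂(Measure.pi fun h : Fin H => M.rew c (x h.castSucc) (π c (x h.castSucc))) := by
  unfold CMDP.episodeLaw
  rw [lintegral_finsetSum_measure]
  refine Finset.sum_congr rfl fun c _ => ?_
  rw [lintegral_finsetSum_measure]
  refine Finset.sum_congr rfl fun x _ => ?_
  rw [lintegral_smul_measure, lintegral_map hφ (by fun_prop), smul_eq_mul]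

/-- An upper bound for the integral of a function of an episode, from bounds for its conditional
integrals given the context and the states. -/
theorem CMDP.lintegral_episodeLaw_le (M : CMDP C S A H) (π : C → S → A)
    {φ : Traj C S A H → ENNReal} (hφ : Measurable φ) {b : C → (Fin (H + 1) → S) → ℝ}
    (hb : ∀ c x, 0 ≤ b c x)
    (h : ∀ c x, ∫⁻ r, φ (c, x, (fun h => π c (x h.castSucc)), r)
            ∂(Measure.pi fun h : Fin H => M.rew c (x h.castSucc) (π c (x h.castSucc))) ≤
        ENNReal.ofReal (b c x)) :
    ∫⁻ τ, φ τ ∂(M.episodeLaw π) ≤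
      ENNReal.ofReal (∑ c, M.wt c * ∑ x, pathProb M.s0 (M.dyn c) (π c) x * b c x) := by
  rw [M.lintegral_episodeLaw π hφ]
  have hp : ∀ c x, 0 ≤ pathProb M.s0 (M.dyn c) (π c) x * b c x := fun c x =>
    mul_nonneg (pathProb_nonneg _ (M.isTransition c) _ _) (hb c x)
  rw [ENNReal.ofReal_sum_of_nonneg fun c _ =>
    mul_nonneg (M.wt_nonneg c) (Finset.sum_nonneg fun x _ => hp c x)]
  refine Finset.sum_le_sum fun c _ => ?_
  rw [ENNReal.ofReal_mul (M.wt_nonneg c), ENNReal.ofReal_sum_of_nonneg fun x _ => hp c x,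
    Finset.mul_sum]
  refine Finset.sum_le_sum fun x _ => ?_
  rw [ENNReal.ofReal_mul (pathProb_nonneg _ (M.isTransition c) _ _), mul_assoc, CMDP.wt,
    ENNReal.ofReal_toReal (M.ctx.apply_ne_top c)]
  gcongr
  exact h c x

instance (M : CMDP C S A H) (π : C → S → A) : IsProbabilityMeasure (M.episodeLaw π) := by
  constructor
  have := fun c s a => M.isProb_rew c s a
  have h := M.lintegral_episodeLaw π (φ := fun _ => 1) measurable_const
  simp only [lintegral_const, measure_univ, mul_one, one_mul] at h
  rw [h]
  simp_rw [← Finset.mul_sum]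
  have h1 : ∀ c, ∑ x : Fin (H + 1) → S, ENNReal.ofReal (pathProb M.s0 (M.dyn c) (π c) x) = 1 := by
    intro c
    rw [← ENNReal.ofReal_sum_of_nonneg fun x _ => pathProb_nonneg _ (M.isTransition c) _ _,
      sum_pathProb _ _ (M.isTransition c), ENNReal.ofReal_one]
  simp_rw [h1, mul_one]
  rw [← M.ctx.tsum_coe, tsum_fintype]

end EpisodeLaw

/-! ### The law of the history and products of conditional factors -/

section HistoryLaw

/-- No measurability of the planner is needed: the oracles take values in finite classes, so the
policy factors through a function on the finite type `Fin (n + 1) → F × Fp`, which is automatically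
measurable. -/
theorem Alg.measurable_policy {C S A : Type*} [Fintype C] [Fintype S] [Fintype A]
    [DecidableEq S] [DecidableEq A] [MeasurableSpace C] [MeasurableSpace S] [MeasurableSpace A]
    {H : ℕ} (𝒜 : Alg C S A H) {F : Finset (C → S → A → ℝ)}
    {Fp : Finset (C → S → A → S → ℝ)} (hF : IsRewOracle F 𝒜.rewOracle)
    (hP : IsDynOracle Fp 𝒜.dynOracle) (n : ℕ) :
    Measurable fun σ : Fin n → Traj C S A H => 𝒜.policy σ := by
  let Φ : (Fin n → Traj C S A H) → Fin (n + 1) → F × Fp := fun σ i =>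
    (⟨𝒜.rewOracle i fun j => σ (Fin.castLE (Nat.le_of_lt_succ i.2) j), ((hF i).2 _).1⟩,
      ⟨𝒜.dynOracle i fun j => σ (Fin.castLE (Nat.le_of_lt_succ i.2) j), ((hP i).2 _).1⟩)
  let Ψ : (Fin (n + 1) → F × Fp) → C → S → A := fun φ c =>
    𝒜.policySeq
      (fun i => if hi : i ≤ n then (φ ⟨i, Nat.lt_succ_of_le hi⟩).1.1 else 0)
      (fun i => if hi : i ≤ n then (φ ⟨i, Nat.lt_succ_of_le hi⟩).2.1 else 0) c n
  have hΦ : Measurable Φ := by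
    refine measurable_pi_lambda _ fun i => Measurable.prodMk ?_ ?_
    · exact ((hF i).1.comp (by fun_prop : Measurable fun (σ : Fin n → Traj C S A H) (j : Fin i) =>
        σ (Fin.castLE (Nat.le_of_lt_succ i.2) j))).subtype_mk
    · exact ((hP i).1.comp (by fun_prop : Measurable fun (σ : Fin n → Traj C S A H) (j : Fin i) =>
        σ (Fin.castLE (Nat.le_of_lt_succ i.2) j))).subtype_mk
  have : MeasurableSingletonClass F := inferInstance
  have : MeasurableSingletonClass Fp := inferInstance
  have : MeasurableSingletonClass (F × Fp) := inferInstance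
  exact (measurable_of_finite Ψ).comp hΦ

variable {C S A : Type*} [Fintype C] [Fintype S] [Fintype A] [DecidableEq S] [DecidableEq A]
  [MeasurableSpace C] [MeasurableSpace S] [MeasurableSpace A] [MeasurableSingletonClass A] {H : ℕ}

/-- The law of the next episode as a kernel. -/
def Alg.nextKernel (𝒜 : Alg C S A H) (M : CMDP C S A H) {n : ℕ}
    (h : Measurable fun σ : Fin n → Traj C S A H => 𝒜.policy σ) :
    Kernel (Fin n → Traj C S A H) (Traj C S A H) where
  toFun σ := M.episodeLaw (𝒜.policy σ)
  measurable' := (measurable_of_finite fun π : C → S → A => M.episodeLaw π).comp h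

instance (𝒜 : Alg C S A H) (M : CMDP C S A H) {n : ℕ}
    (h : Measurable fun σ : Fin n → Traj C S A H => 𝒜.policy σ) :
    IsMarkovKernel (𝒜.nextKernel M h) :=
  ⟨fun σ => inferInstanceAs (IsProbabilityMeasure (M.episodeLaw (𝒜.policy σ)))⟩

theorem Alg.lintegral_historyLaw_succ (𝒜 : Alg C S A H) (M : CMDP C S A H) {n : ℕ}
    (h : Measurable fun σ : Fin n → Traj C S A H => 𝒜.policy σ)
    {φ : (Fin (n + 1) → Traj C S A H) → ENNReal} (hφ : Measurable φ) :
    ∫⁻ σ, φ σ ∂(𝒜.historyLaw M (n + 1)) =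
      ∫⁻ σ, ∫⁻ τ, φ (Fin.snoc (α := fun _ => Traj C S A H) σ τ)
        ∂(M.episodeLaw (𝒜.policy σ)) ∂(𝒜.historyLaw M n) := by
  have hs := measurable_snoc (E := Traj C S A H) n
  have hm : Measurable fun σ : Fin n → Traj C S A H => (M.episodeLaw (𝒜.policy σ)).map
      fun τ => (Fin.snoc (α := fun _ => Traj C S A H) σ τ : Fin (n + 1) → Traj C S A H) := by
    have := ((Kernel.id ×ₖ 𝒜.nextKernel M h).map fun p =>
      (Fin.snoc (α := fun _ => Traj C S A H) p.1 p.2 : Fin (n + 1) → Traj C S A H)).measurable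
    convert this using 2 with σ
    rw [Kernel.map_apply _ hs, Kernel.prod_apply, Kernel.id_apply, Measure.dirac_prod,
      Measure.map_map hs measurable_prodMk_left]
    rfl
  rw [Alg.historyLaw, Measure.lintegral_bind hm.aemeasurable hφ.aemeasurable]
  refine lintegral_congr fun σ => ?_
  exact lintegral_map hφ (hs.comp measurable_prodMk_left)

theorem Alg.historyLaw_univ (𝒜 : Alg C S A H) (M : CMDP C S A H)
    (h : ∀ n, Measurable fun σ : Fin n → Traj C S A H => 𝒜.policy σ) (n : ℕ) :
    𝒜.historyLaw M n Set.univ = 1 := by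
  rw [← lintegral_one]
  induction n with
  | zero => simp [Alg.historyLaw]
  | succ n ih =>
    rw [𝒜.lintegral_historyLaw_succ M (h n) measurable_const]
    simpa using ih

/-- A product of conditionally sub-normalized factors has integral at most one. -/
theorem Alg.lintegral_prod_le_one (𝒜 : Alg C S A H) (M : CMDP C S A H)
    (h : ∀ n, Measurable fun σ : Fin n → Traj C S A H => 𝒜.policy σ)
    (g : (n : ℕ) → (Fin n → Traj C S A H) → Traj C S A H → ENNReal)
    (hg : ∀ n, Measurable fun p : (Fin n → Traj C S A H) × Traj C S A H => g n p.1 p.2)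
    (hle : ∀ n σ, ∫⁻ τ, g n σ τ ∂(M.episodeLaw (𝒜.policy σ)) ≤ 1) (T : ℕ) :
    ∫⁻ σ, ∏ t : Fin T, g t (fun j : Fin t => σ (Fin.castLE t.2.le j)) (σ t)
      ∂(𝒜.historyLaw M T) ≤ 1 := by
  have hmeas : ∀ T, Measurable fun σ : Fin T → Traj C S A H =>
      ∏ t : Fin T, g t (fun j : Fin t => σ (Fin.castLE t.2.le j)) (σ t) := by
    intro T
    refine Finset.measurable_prod _ fun t _ => ?_
    exact (hg t).comp (by fun_prop : Measurable fun σ : Fin T → Traj C S A H =>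
      ((fun j : Fin t => σ (Fin.castLE t.2.le j)), σ t))
  induction T with
  | zero => simp [Alg.historyLaw]
  | succ n ih =>
    rw [𝒜.lintegral_historyLaw_succ M (h n) (hmeas (n + 1))]
    refine le_trans (lintegral_mono fun σ => ?_) ih
    -- Appending an episode does not change the prefixes of length at most `n`, so only the last
    -- factor depends on `τ`.
    have hpre : ∀ (t : ℕ) (ht : t ≤ n) (τ : Traj C S A H),
        (fun j : Fin t => (Fin.snoc (α := fun _ => Traj C S A H) σ τ :
          Fin (n + 1) → Traj C S A H) (Fin.castLE (ht.trans n.le_succ) j)) =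
        fun j => σ (Fin.castLE ht j) := by
      intro t ht τ
      ext1 j
      have : Fin.castLE (ht.trans n.le_succ) j = (Fin.castLE ht j).castSucc := rfl
      rw [this, Fin.snoc_castSucc]
    simp only [Fin.prod_univ_castSucc, Fin.snoc_castSucc, Fin.snoc_last, Fin.val_castSucc,
      Fin.val_last]
    have e1 : ∀ (t : Fin n) (τ : Traj C S A H), _ := fun t τ => hpre t t.2.le τ
    have e2 : ∀ (τ : Traj C S A H), _ = σ := fun τ => hpre n le_rfl τ
    simp only [e1, e2]
    have hgn : Measurable fun τ => g n σ τ := (hg n).comp measurable_prodMk_left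
    rw [lintegral_const_mul _ hgn]
    exact (mul_le_mul_right (hle n _) _).trans (by rw [mul_one])

end HistoryLaw

/-! ### Exponential moments under a variance-mean condition -/

section Exponential

theorem sum_mul_affine {ι : Type*} [Fintype ι] {w : ι → ℝ} (hw : ∑ i, w i = 1) (E k : ℝ)
    (u : ι → ℝ) : ∑ i, w i * (E * (1 + k * u i)) = E * (1 + k * ∑ i, w i * u i) := by
  calc ∑ i, w i * (E * (1 + k * u i)) = ∑ i, (w i * E + E * k * (w i * u i)) :=
        Finset.sum_congr rfl fun i _ => by ring
    _ = _ := by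
        rw [Finset.sum_add_distrib, ← Finset.sum_mul, hw, ← Finset.mul_sum]
        ring

theorem exp_neg_le_of_abs_le_one {x : ℝ} (hx : |x| ≤ 1) : Real.exp (-x) ≤ 1 - x + x ^ 2 := by
  have := (abs_le.1 (Real.abs_exp_sub_one_sub_id_le (x := -x) (by simpa using hx))).2
  nlinarith

/-- A Bernstein-type bound. The scale `8bH` keeps the exponent in `[-1,1]`, and Cauchy-Schwarz with
`V ≤ 4b` makes the quadratic term half of `(∑ d) / (8bH)`. When `y` has mean `d`, half of the linear
term survives. It is used with `(b, V) = (1, 4)` for rewards and `(2, 8)` for dynamics. -/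
theorem exp_neg_sum_le {H : ℕ} (hH : 1 ≤ H) {b V : ℝ} (hb : 0 < b) {y d : Fin H → ℝ}
    (hy : ∀ h, |y h| ≤ b) (hyd : ∀ h, y h ^ 2 ≤ V * d h) (hV : V ≤ 4 * b) (hd : ∀ h, 0 ≤ d h) :
    Real.exp (-((∑ h, y h) / (8 * b * H))) ≤
      1 - (∑ h, y h) / (8 * b * H) + (∑ h, d h) / (16 * b * H) := by
  have hH' : (1 : ℝ) ≤ H := by exact_mod_cast hH
  have hpos : 0 < 8 * b * H := by positivity
  have habs : |∑ h, y h| ≤ b * H := by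
    refine (Finset.abs_sum_le_sum_abs _ _).trans ((Finset.sum_le_sum fun h _ => hy h).trans ?_)
    simp [mul_comm]
  have h1 : |(∑ h, y h) / (8 * b * H)| ≤ 1 := by
    rw [abs_div, abs_of_pos hpos, div_le_one hpos]
    nlinarith [mul_pos hb (by linarith : (0 : ℝ) < H)]
  refine (exp_neg_le_of_abs_le_one h1).trans ?_
  have h2 : (∑ h, y h) ^ 2 ≤ H * (4 * b * ∑ h, d h) := by
    refine (sq_sum_le_card_mul_sum_sq (s := Finset.univ) (f := y)).trans ?_
    rw [Finset.card_univ, Fintype.card_fin, Finset.mul_sum _ _ (4 * b)]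
    exact mul_le_mul_of_nonneg_left (Finset.sum_le_sum fun h _ =>
      (hyd h).trans (mul_le_mul_of_nonneg_right hV (hd h))) (by positivity)
  have h3 : ((∑ h, y h) / (8 * b * H)) ^ 2 ≤ (∑ h, d h) / (16 * b * H) := by
    rw [div_pow, div_le_div_iff₀ (by positivity) (by positivity)]
    have := mul_le_mul_of_nonneg_right h2 (by positivity : 0 ≤ 16 * b * (H : ℝ))
    nlinarith
  linarith

/-- Conditional exponential moment of the excess squared losses of independent observations. -/
theorem lintegral_exp_neg_excess_le {H : ℕ} (hH : 1 ≤ H) (μ : Fin H → Measure ℝ)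
    [∀ h, IsProbabilityMeasure (μ h)] (hμ : ∀ h, ∀ᵐ x ∂(μ h), x ∈ Set.Icc (0 : ℝ) 1)
    {u v : Fin H → ℝ} (hu : ∀ h, u h ∈ Set.Icc (0 : ℝ) 1) (hv : ∀ h, v h ∈ Set.Icc (0 : ℝ) 1)
    (hmean : ∀ h, ∫ x, x ∂(μ h) = v h) :
    ∫⁻ r, ENNReal.ofReal (Real.exp (-((∑ h, ((u h - r h) ^ 2 - (v h - r h) ^ 2)) / (8 * H))))
      ∂(Measure.pi μ) ≤ ENNReal.ofReal (1 - (∑ h, (u h - v h) ^ 2) / (16 * H)) := by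
  have hH' : (1 : ℝ) ≤ H := by exact_mod_cast hH
  set d := ∑ h, (u h - v h) ^ 2 with hd
  have hmem : ∀ᵐ r ∂(Measure.pi μ), ∀ h, r h ∈ Set.Icc (0 : ℝ) 1 :=
    ae_all_iff.2 fun h => (Measure.quasiMeasurePreserving_eval μ h).ae (hμ h)
  -- An affine majorant of the exponential, so that only the means of the coordinates enter its
  -- integral.
  let g : (Fin H → ℝ) → ℝ := fun r =>
    1 + d / (16 * H) - (∑ h, (u h - v h) * (u h + v h - 2 * r h)) / (8 * H)
  have hle : ∀ᵐ r ∂(Measure.pi μ),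
      Real.exp (-((∑ h, ((u h - r h) ^ 2 - (v h - r h) ^ 2)) / (8 * H))) ≤ g r := by
    filter_upwards [hmem] with r hr
    have := exp_neg_sum_le hH (b := 1) (V := 4) one_pos
      (y := fun h => (u h - r h) ^ 2 - (v h - r h) ^ 2) (d := fun h => (u h - v h) ^ 2)
      (fun h => ?_) (fun h => ?_) (by norm_num) (fun h => sq_nonneg _)
    · simp only [mul_one] at this
      refine this.trans (le_of_eq ?_)
      simp only [g, hd]
      have : ∀ h, (u h - r h) ^ 2 - (v h - r h) ^ 2 = (u h - v h) * (u h + v h - 2 * r h) :=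
        fun h => by ring
      simp_rw [this]
      ring
    · obtain ⟨h1, h2⟩ := hu h
      obtain ⟨h3, h4⟩ := hv h
      obtain ⟨h5, h6⟩ := hr h
      rw [abs_le]
      constructor <;> nlinarith
    · obtain ⟨h1, h2⟩ := hu h
      obtain ⟨h3, h4⟩ := hv h
      obtain ⟨h5, h6⟩ := hr h
      have : (u h + v h - 2 * r h) ^ 2 ≤ 4 := by nlinarith
      calc ((u h - r h) ^ 2 - (v h - r h) ^ 2) ^ 2
          = (u h + v h - 2 * r h) ^ 2 * (u h - v h) ^ 2 := by ring
        _ ≤ 4 * (u h - v h) ^ 2 := mul_le_mul_of_nonneg_right this (sq_nonneg _)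
  have hint1 : ∀ h, Integrable (fun x : ℝ => x) (μ h) := by
    intro h
    refine Integrable.of_bound (C := 1) measurable_id.aestronglyMeasurable ?_
    filter_upwards [hμ h] with x hx
    rw [Real.norm_eq_abs, abs_le]
    exact ⟨by linarith [hx.1], hx.2⟩
  have hint2 : ∀ h, Integrable (fun r : Fin H → ℝ => r h) (Measure.pi μ) := fun h =>
    integrable_comp_eval (μ := μ) (i := h) (f := fun x : ℝ => x) (hint1 h)
  have hint3 : ∀ h, Integrable (fun r : Fin H → ℝ => (u h - v h) * (u h + v h - 2 * r h))
      (Measure.pi μ) := fun h =>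
    ((integrable_const _).sub ((hint2 h).const_mul 2)).const_mul _
  have hint4 : Integrable (fun r : Fin H → ℝ =>
      (∑ h, (u h - v h) * (u h + v h - 2 * r h)) / (8 * H)) (Measure.pi μ) :=
    (integrable_finsetSum _ fun h _ => hint3 h).div_const _
  have hgint : Integrable g (Measure.pi μ) := (integrable_const _).sub hint4
  have hval : ∫ r, g r ∂(Measure.pi μ) = 1 - d / (16 * H) := by
    have e1 : ∀ h, ∫ r : Fin H → ℝ, (u h - v h) * (u h + v h - 2 * r h) ∂(Measure.pi μ) =
        (u h - v h) ^ 2 := by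
      intro h
      rw [integral_const_mul, integral_sub (integrable_const _) ((hint2 h).const_mul 2),
        integral_const_mul, integral_comp_eval (μ := μ) (i := h)
          (f := fun x : ℝ => x) (hint1 h).aestronglyMeasurable, hmean h]
      simp
      ring
    simp only [g]
    rw [integral_sub (integrable_const _) hint4, integral_div,
      integral_finsetSum _ fun h _ => hint3 h]
    simp_rw [e1, ← hd]
    simp
    field_simp
    ring
  have hg0 : 0 ≤ᵐ[Measure.pi μ] g := by
    filter_upwards [hle] with r hr using (Real.exp_pos _).le.trans hr
  rw [← hval, ofReal_integral_eq_lintegral_ofReal hgint hg0]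
  refine lintegral_mono_ae ?_
  filter_upwards [hle] with r hr using ENNReal.ofReal_le_ofReal hr

/-- Turns a conditional moment bound `1 - x` into a factor of mean at most one after compensation by
`exp x`. -/
theorem exp_mul_one_sub_le_one (x : ℝ) : Real.exp x * (1 - x) ≤ 1 := by
  have h := Real.add_one_le_exp (-x)
  calc Real.exp x * (1 - x) ≤ Real.exp x * Real.exp (-x) :=
        mul_le_mul_of_nonneg_left (by linarith) (Real.exp_pos _).le
    _ = 1 := by rw [← Real.exp_add]; simp

end Exponential

/-! ### Excess squared loss of a predicted transition law -/

section Multinomial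

variable {S : Type*} [Fintype S] [DecidableEq S]

theorem sum_sub_indicator_sq_le_two {p : S → ℝ} (h0 : ∀ s, 0 ≤ p s) (h1 : ∑ s, p s = 1) (t : S) :
    ∑ s, (p s - if s = t then 1 else 0) ^ 2 ≤ 2 := by
  have hle : ∀ s, p s ≤ 1 := fun s =>
    h1 ▸ Finset.single_le_sum (f := p) (fun i _ => h0 i) (Finset.mem_univ s)
  calc ∑ s, (p s - if s = t then 1 else 0) ^ 2 ≤ ∑ s, (p s + if s = t then 1 else 0) := by
        refine Finset.sum_le_sum fun s _ => ?_
        have := h0 s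
        have := hle s
        split_ifs <;> nlinarith
    _ = 2 := by rw [Finset.sum_add_distrib, h1]; simp; norm_num

theorem abs_excess_le_two {p q : S → ℝ} (hp0 : ∀ s, 0 ≤ p s) (hp1 : ∑ s, p s = 1)
    (hq0 : ∀ s, 0 ≤ q s) (hq1 : ∑ s, q s = 1) (t : S) :
    |∑ s, (p s - if s = t then 1 else 0) ^ 2 - ∑ s, (q s - if s = t then 1 else 0) ^ 2| ≤ 2 := by
  have h1 := sum_sub_indicator_sq_le_two hp0 hp1 t
  have h2 := sum_sub_indicator_sq_le_two hq0 hq1 t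
  have h3 : 0 ≤ ∑ s, (p s - if s = t then 1 else 0) ^ 2 := Finset.sum_nonneg fun s _ => sq_nonneg _
  have h4 : 0 ≤ ∑ s, (q s - if s = t then 1 else 0) ^ 2 := Finset.sum_nonneg fun s _ => sq_nonneg _
  rw [abs_le]
  constructor <;> linarith

/-- With `e` the indicator of the outcome, the excess factors as `∑ (p - q)(p + q - 2e)`.
Cauchy-Schwarz applies, and `∑ (p + q - 2e)² ≤ 8` by the parallelogram inequality. -/
theorem excess_sq_le {p q : S → ℝ} (hp0 : ∀ s, 0 ≤ p s) (hp1 : ∑ s, p s = 1)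
    (hq0 : ∀ s, 0 ≤ q s) (hq1 : ∑ s, q s = 1) (t : S) :
    (∑ s, (p s - if s = t then 1 else 0) ^ 2 - ∑ s, (q s - if s = t then 1 else 0) ^ 2) ^ 2 ≤
      8 * ∑ s, (p s - q s) ^ 2 := by
  set e : S → ℝ := fun s => if s = t then 1 else 0 with he
  have h1 : ∑ s, (p s - e s) ^ 2 ≤ 2 := sum_sub_indicator_sq_le_two hp0 hp1 t
  have h2 : ∑ s, (q s - e s) ^ 2 ≤ 2 := sum_sub_indicator_sq_le_two hq0 hq1 t
  have h3 : ∑ s, (p s + q s - 2 * e s) ^ 2 ≤ 8 := by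
    calc ∑ s, (p s + q s - 2 * e s) ^ 2 ≤ ∑ s, (2 * (p s - e s) ^ 2 + 2 * (q s - e s) ^ 2) := by
          refine Finset.sum_le_sum fun s _ => ?_
          nlinarith [sq_nonneg (p s - q s)]
      _ ≤ 8 := by rw [Finset.sum_add_distrib, ← Finset.mul_sum, ← Finset.mul_sum]; linarith
  have h4 : ∑ s, (p s - e s) ^ 2 - ∑ s, (q s - e s) ^ 2 =
      ∑ s, (p s - q s) * (p s + q s - 2 * e s) := by
    rw [← Finset.sum_sub_distrib]
    exact Finset.sum_congr rfl fun s _ => by ring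
  rw [h4, mul_comm]
  refine (Finset.sum_mul_sq_le_sq_mul_sq _ _ _).trans ?_
  exact mul_le_mul_of_nonneg_left h3 (Finset.sum_nonneg fun s _ => sq_nonneg _)

/-- The squared loss is a proper score: under the true law `q`, the mean excess is the squared
distance. With `excess_sq_le` this controls the second moment of the excess by its mean. -/
theorem sum_mul_excess (p : S → ℝ) {q : S → ℝ} (hq1 : ∑ s, q s = 1) :
    ∑ t, q t * (∑ s, (p s - if s = t then 1 else 0) ^ 2 -
      ∑ s, (q s - if s = t then 1 else 0) ^ 2) = ∑ s, (p s - q s) ^ 2 := by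
  have h4 : ∀ t, ∑ s, (p s - if s = t then 1 else 0) ^ 2 - ∑ s, (q s - if s = t then 1 else 0) ^ 2 =
      ∑ s, (p s ^ 2 - q s ^ 2) - 2 * (p t - q t) := by
    intro t
    rw [← Finset.sum_sub_distrib]
    have : ∀ s, (p s - if s = t then 1 else 0) ^ 2 - (q s - if s = t then 1 else 0) ^ 2 =
        (p s ^ 2 - q s ^ 2) - if s = t then 2 * (p s - q s) else 0 := by
      intro s
      split_ifs <;> ring
    simp_rw [this]
    rw [Finset.sum_sub_distrib]
    simp
  simp_rw [h4, mul_sub, Finset.sum_sub_distrib]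
  rw [← Finset.sum_mul, hq1, one_mul, ← Finset.sum_sub_distrib,
    ← Finset.sum_sub_distrib, ← Finset.sum_sub_distrib]
  exact Finset.sum_congr rfl fun s _ => by ring

end Multinomial

/-! ### Excess losses and regret of a single episode -/

section Episodes

variable {C S A : Type*} [Fintype S] {H : ℕ}

/-- Excess squared loss of `f` on an episode. -/
def CMDP.rewGap (M : CMDP C S A H) (f : C → S → A → ℝ) (τ : Traj C S A H) : ℝ :=
  ∑ h : Fin H, ((f τ.1 (τ.2.1 h.castSucc) (τ.2.2.1 h) - τ.2.2.2 h) ^ 2 -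
    (M.meanRew τ.1 (τ.2.1 h.castSucc) (τ.2.2.1 h) - τ.2.2.2 h) ^ 2)

theorem rewLoss_sub_rewLoss (M : CMDP C S A H) (f : C → S → A → ℝ) {n : ℕ}
    (σ : Fin n → Traj C S A H) :
    rewLoss f σ - rewLoss M.meanRew σ = ∑ i, M.rewGap f (σ i) := by
  simp only [rewLoss, CMDP.rewGap, Finset.sum_sub_distrib]

theorem CMDP.measurable_rewGap [Fintype C] [Fintype A] [MeasurableSpace C] [MeasurableSpace S]
    [MeasurableSpace A] [MeasurableSingletonClass C] [MeasurableSingletonClass S]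
    [MeasurableSingletonClass A] (M : CMDP C S A H) (f : C → S → A → ℝ) :
    Measurable (M.rewGap f) := by
  unfold CMDP.rewGap
  have hm : ∀ g : C → S → A → ℝ, Measurable fun p : C × S × A => g p.1 p.2.1 p.2.2 :=
    fun g => measurable_of_finite _
  have hm' : ∀ (g : C → S → A → ℝ) (h : Fin H), Measurable fun τ : Traj C S A H =>
      g τ.1 (τ.2.1 h.castSucc) (τ.2.2.1 h) := fun g h =>
    (hm g).comp (by fun_prop : Measurable fun τ : Traj C S A H =>
      (τ.1, τ.2.1 h.castSucc, τ.2.2.1 h))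
  refine Finset.measurable_sum _ fun h _ => ?_
  have h1 := hm' f h
  have h2 := hm' M.meanRew h
  fun_prop

variable [DecidableEq S]

/-- Excess squared loss of the dynamics `P` on an episode. -/
def CMDP.dynGap (M : CMDP C S A H) (P : C → S → A → S → ℝ) (τ : Traj C S A H) : ℝ :=
  ∑ h : Fin H,
    (∑ s', (P τ.1 (τ.2.1 h.castSucc) (τ.2.2.1 h) s' - if s' = τ.2.1 h.succ then 1 else 0) ^ 2 -
      ∑ s', (M.dyn τ.1 (τ.2.1 h.castSucc) (τ.2.2.1 h) s' -
        if s' = τ.2.1 h.succ then 1 else 0) ^ 2)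

/-- Expected squared error, in the context `c`, of the reward function `f` along an episode. -/
def CMDP.rewDevAt (M : CMDP C S A H) (f : C → S → A → ℝ) (c : C) (π : S → A) : ℝ :=
  value H M.s0 (M.dyn c) (fun s a => (f c s a - M.meanRew c s a) ^ 2) π

/-- Expected squared error, in the context `c`, of the dynamics `P` along an episode. -/
def CMDP.dynDevAt (M : CMDP C S A H) (P : C → S → A → S → ℝ) (c : C) (π : S → A) : ℝ :=
  value H M.s0 (M.dyn c) (fun s a => ∑ s', (P c s a s' - M.dyn c s a s') ^ 2) π

theorem dynLoss_sub_dynLoss (M : CMDP C S A H) (P : C → S → A → S → ℝ) {n : ℕ}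
    (σ : Fin n → Traj C S A H) :
    dynLoss P σ - dynLoss M.dyn σ = ∑ i, M.dynGap P (σ i) := by
  simp only [dynLoss, CMDP.dynGap, Finset.sum_sub_distrib]

variable [Fintype C]

/-- Expected squared error of the reward function `f` along an episode of `π`. -/
def CMDP.rewDev (M : CMDP C S A H) (f : C → S → A → ℝ) (π : C → S → A) : ℝ :=
  ∑ c, M.wt c * M.rewDevAt f c (π c)

/-- Expected squared error of the dynamics `P` along an episode of `π`. -/
def CMDP.dynDev (M : CMDP C S A H) (P : C → S → A → S → ℝ) (π : C → S → A) : ℝ :=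
  ∑ c, M.wt c * M.dynDevAt P c (π c)

/-- Expected regret of one episode of `π`. -/
def CMDP.meanRegret (M : CMDP C S A H) (πs π : C → S → A) : ℝ :=
  ∑ c, M.wt c * (M.val c (πs c) - M.val c (π c))

variable [MeasurableSpace C] [MeasurableSpace S] [MeasurableSpace A] [MeasurableSingletonClass C]

/-- Optimality of `πs` puts the regret divided by `H` in `[0,1]`, where `exp y ≤ 1 + y + y² ≤ 1 +
2y`. Hence twice the mean compensates, with no variance term. -/
theorem CMDP.lintegral_exp_regret_le (M : CMDP C S A H) (hH : 1 ≤ H)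
    (hM : ∀ c s a, M.meanRew c s a ∈ Set.Icc (0 : ℝ) 1) {πs : C → S → A} (hπs : M.IsOptimal πs)
    (π : C → S → A) :
    ∫⁻ τ, ENNReal.ofReal (Real.exp ((M.val τ.1 (πs τ.1) - M.val τ.1 (π τ.1)) / H -
        2 * M.meanRegret πs π / H)) ∂(M.episodeLaw π) ≤ 1 := by
  have hH' : (1 : ℝ) ≤ H := by exact_mod_cast hH
  have := fun c s a => M.isProb_rew c s a
  let R : C → ℝ := fun c => M.val c (πs c) - M.val c (π c)
  have hR : Measurable R := measurable_of_finite R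
  have hR0 : ∀ c, 0 ≤ R c := fun c => sub_nonneg.2 (hπs c _)
  have hR1 : ∀ c, R c ≤ H := by
    intro c
    have h1 : M.val c (πs c) ≤ H :=
      value_le H M.s0 (M.isTransition c) (fun s a => (hM c s a).2) _
    have h2 : 0 ≤ M.val c (π c) :=
      value_nonneg H M.s0 (M.isTransition c) (fun s a => (hM c s a).1) _
    simp only [R]
    linarith
  set m := 2 * M.meanRegret πs π / H with hm
  refine (M.lintegral_episodeLaw_le π (φ := fun τ => ENNReal.ofReal (Real.exp (R τ.1 / H - m)))
    (by fun_prop) (b := fun c x => Real.exp (R c / H - m))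
    (fun c x => by positivity) fun c x => by simp).trans ?_
  rw [← ENNReal.ofReal_one]
  refine ENNReal.ofReal_le_ofReal ?_
  have e : ∀ c, ∑ x : Fin (H + 1) → S, pathProb M.s0 (M.dyn c) (π c) x * Real.exp (R c / H - m) ≤
      Real.exp (-m) * (1 + 2 * R c / H) := by
    intro c
    rw [← Finset.sum_mul, sum_pathProb H M.s0 (M.isTransition c), one_mul, sub_eq_neg_add,
      Real.exp_add]
    refine mul_le_mul_of_nonneg_left ?_ (Real.exp_pos _).le
    have h0 : 0 ≤ R c / H := div_nonneg (hR0 c) (by positivity)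
    have h1 : R c / H ≤ 1 := (div_le_one (by positivity)).2 (hR1 c)
    have := exp_neg_le_of_abs_le_one (x := -(R c / H)) (by rwa [abs_neg, abs_of_nonneg h0])
    rw [neg_neg] at this
    rw [mul_div_assoc]
    nlinarith
  refine (Finset.sum_le_sum fun c _ => mul_le_mul_of_nonneg_left (e c) (M.wt_nonneg c)).trans ?_
  refine le_trans (le_of_eq ?_) (exp_mul_one_sub_le_one (-m))
  have e2 := sum_mul_affine M.sum_wt (Real.exp (-m)) (2 / H) R
  calc _ = _ := Finset.sum_congr rfl fun c _ => by ring
    _ = _ := e2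
    _ = Real.exp (-m) * (1 + 2 / H * M.meanRegret πs π) := rfl
    _ = _ := by rw [hm]; ring

variable [MeasurableSingletonClass S] [MeasurableSingletonClass A]
  [Fintype A]

theorem CMDP.measurable_dynGap (M : CMDP C S A H) (P : C → S → A → S → ℝ) :
    Measurable (M.dynGap P) := by
  let g : (C → S → A → S → ℝ) → C × S × A × S → ℝ := fun Q p =>
    ∑ s', (Q p.1 p.2.1 p.2.2.1 s' - if s' = p.2.2.2 then 1 else 0) ^ 2
  have hg : ∀ Q, Measurable (g Q) := fun Q => measurable_of_finite (g Q)
  let v : Fin H → Traj C S A H → C × S × A × S := fun h τ =>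
    (τ.1, τ.2.1 h.castSucc, τ.2.2.1 h, τ.2.1 h.succ)
  have hv : ∀ h, Measurable (v h) := fun h => by fun_prop
  have hsum : Measurable fun τ => ∑ h, (g P (v h τ) - g M.dyn (v h τ)) :=
    Finset.measurable_sum _ fun h _ => ((hg P).comp (hv h)).sub ((hg M.dyn).comp (hv h))
  exact hsum

/-- Given context and states, the moment is at most `1 - d/(16H)`. This is affine in `d`, so
averaging over paths and contexts replaces `d` by `rewDev`. -/
theorem CMDP.lintegral_exp_rewGap_le (M : CMDP C S A H) (hH : 1 ≤ H) {f : C → S → A → ℝ}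
    (hf : ∀ c s a, f c s a ∈ Set.Icc (0 : ℝ) 1) (hM : ∀ c s a, M.meanRew c s a ∈ Set.Icc (0 : ℝ) 1)
    (π : C → S → A) :
    ∫⁻ τ, ENNReal.ofReal (Real.exp (M.rewDev f π / (16 * H) - M.rewGap f τ / (8 * H)))
      ∂(M.episodeLaw π) ≤ 1 := by
  have hH' : (1 : ℝ) ≤ H := by exact_mod_cast hH
  have := fun c s a => M.isProb_rew c s a
  have hmeas := M.measurable_rewGap f
  let d : C → (Fin (H + 1) → S) → ℝ := fun c x =>
    ∑ h : Fin H, (f c (x h.castSucc) (π c (x h.castSucc)) -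
      M.meanRew c (x h.castSucc) (π c (x h.castSucc))) ^ 2
  have hd : ∀ c x, d c x ≤ H := by
    intro c x
    refine (Finset.sum_le_sum (g := fun _ => (1 : ℝ)) fun h _ => ?_).trans (by simp)
    obtain ⟨h1, h2⟩ := hf c (x h.castSucc) (π c (x h.castSucc))
    obtain ⟨h3, h4⟩ := hM c (x h.castSucc) (π c (x h.castSucc))
    nlinarith
  refine (M.lintegral_episodeLaw_le π (by fun_prop)
    (b := fun c x => Real.exp (M.rewDev f π / (16 * H)) * (1 - d c x / (16 * H)))
    (fun c x => mul_nonneg (Real.exp_pos _).le ?_) fun c x => ?_).trans ?_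
  · rw [sub_nonneg, div_le_one (by positivity)]
    linarith [hd c x]
  · rw [ENNReal.ofReal_mul (Real.exp_pos _).le]
    refine le_trans (le_of_eq ?_) (mul_le_mul_right (lintegral_exp_neg_excess_le hH
      (fun h : Fin H => M.rew c (x h.castSucc) (π c (x h.castSucc))) (fun h => M.rew_mem _ _ _)
      (fun h => hf c (x h.castSucc) (π c (x h.castSucc))) (fun h => hM _ _ _) fun h => rfl) _)
    rw [← lintegral_const_mul _ (by fun_prop)]
    refine lintegral_congr fun r => ?_
    rw [← ENNReal.ofReal_mul (Real.exp_pos _).le, ← Real.exp_add, ← sub_eq_add_neg]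
    rfl
  · rw [← ENNReal.ofReal_one]
    refine ENNReal.ofReal_le_ofReal (le_trans (le_of_eq ?_)
      (exp_mul_one_sub_le_one (M.rewDev f π / (16 * H))))
    have e : ∀ c, ∑ x, pathProb M.s0 (M.dyn c) (π c) x *
        (Real.exp (M.rewDev f π / (16 * H)) * (1 - d c x / (16 * H))) =
        Real.exp (M.rewDev f π / (16 * H)) * (1 - M.rewDevAt f c (π c) / (16 * H)) := by
      intro c
      have e1 : M.rewDevAt f c (π c) = ∑ x, pathProb M.s0 (M.dyn c) (π c) x * d c x := rfl
      have e2 := sum_mul_affine (sum_pathProb H M.s0 (M.isTransition c) (π c))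
        (Real.exp (M.rewDev f π / (16 * H))) (-(1 / (16 * H))) (d c)
      rw [← e1] at e2
      calc _ = _ := Finset.sum_congr rfl fun x _ => by ring
        _ = _ := e2
        _ = _ := by ring
    simp_rw [e]
    have e2 := sum_mul_affine M.sum_wt (Real.exp (M.rewDev f π / (16 * H))) (-(1 / (16 * H)))
      fun c => M.rewDevAt f c (π c)
    calc _ = _ := Finset.sum_congr rfl fun c _ => by ring
      _ = _ := e2
      _ = _ := by rw [← CMDP.rewDev]; ring

theorem CMDP.lintegral_exp_dynGap_le (M : CMDP C S A H) (hH : 1 ≤ H) {P : C → S → A → S → ℝ}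
    (hP : ∀ c, IsTransition (P c)) (π : C → S → A) :
    ∫⁻ τ, ENNReal.ofReal (Real.exp (M.dynDev P π / (32 * H) - M.dynGap P τ / (16 * H)))
      ∂(M.episodeLaw π) ≤ 1 := by
  have hH' : (1 : ℝ) ≤ H := by exact_mod_cast hH
  have := fun c s a => M.isProb_rew c s a
  have hmeas := M.measurable_dynGap P
  let y : C → S → S → ℝ := fun c s t =>
    ∑ s', (P c s (π c s) s' - if s' = t then 1 else 0) ^ 2 -
      ∑ s', (M.dyn c s (π c s) s' - if s' = t then 1 else 0) ^ 2
  let d : C → S → ℝ := fun c s => ∑ s', (P c s (π c s) s' - M.dyn c s (π c s) s') ^ 2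
  let Y : C → (Fin (H + 1) → S) → ℝ := fun c x => ∑ h : Fin H, y c (x h.castSucc) (x h.succ)
  have hexp : ∀ c x, Real.exp (-(Y c x / (16 * H))) ≤
      1 - Y c x / (16 * H) + (∑ h : Fin H, d c (x h.castSucc)) / (32 * H) := by
    intro c x
    have := exp_neg_sum_le hH (b := 2) (V := 8) two_pos
      (y := fun h => y c (x h.castSucc) (x h.succ)) (d := fun h => d c (x h.castSucc))
      (fun h => abs_excess_le_two ((hP c).1 _ _) ((hP c).2 _ _) ((M.isTransition c).1 _ _)
        ((M.isTransition c).2 _ _) _)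
      (fun h => excess_sq_le ((hP c).1 _ _) ((hP c).2 _ _) ((M.isTransition c).1 _ _)
        ((M.isTransition c).2 _ _) _) (by norm_num)
      (fun h => Finset.sum_nonneg fun s _ => sq_nonneg _)
    norm_num at this
    exact this
  refine (M.lintegral_episodeLaw_le π (by fun_prop)
    (b := fun c x => Real.exp (M.dynDev P π / (32 * H)) * Real.exp (-(Y c x / (16 * H))))
    (fun c x => by positivity) fun c x => ?_).trans ?_
  · rw [← Real.exp_add, ← sub_eq_add_neg]
    have : ∀ r, M.dynGap P (c, x, (fun h => π c (x h.castSucc)), r) = Y c x := fun r => rfl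
    simp [this]
  · rw [← ENNReal.ofReal_one]
    refine ENNReal.ofReal_le_ofReal (le_trans ?_
      (exp_mul_one_sub_le_one (M.dynDev P π / (32 * H))))
    have e : ∀ c, ∑ x, pathProb M.s0 (M.dyn c) (π c) x *
        (Real.exp (M.dynDev P π / (32 * H)) * Real.exp (-(Y c x / (16 * H)))) ≤
        Real.exp (M.dynDev P π / (32 * H)) * (1 - M.dynDevAt P c (π c) / (32 * H)) := by
      intro c
      have e1 : M.dynDevAt P c (π c) = ∑ x : Fin (H + 1) → S, pathProb M.s0 (M.dyn c) (π c) x *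
        ∑ h : Fin H, d c (x h.castSucc) := rfl
      -- Unlike for rewards, the randomness lies in the path itself, so the mean of the excess is
      -- computed transition by transition.
      have e2 : M.dynDevAt P c (π c) = ∑ x : Fin (H + 1) → S, pathProb M.s0 (M.dyn c) (π c) x *
          Y c x := by
        simp only [Y]
        rw [sum_pathProb_mul_sum_transition M.s0 (M.isTransition c) (π c) (y c)]
        simp only [y, sum_mul_excess _ ((M.isTransition c).2 _ _)]
        rfl
      have e3 : 1 - M.dynDevAt P c (π c) / (32 * H) = ∑ x : Fin (H + 1) → S,
          pathProb M.s0 (M.dyn c) (π c) x *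
          (1 - Y c x / (16 * H) + (∑ h : Fin H, d c (x h.castSucc)) / (32 * H)) := by
        simp only [mul_add, mul_sub, Finset.sum_add_distrib, Finset.sum_sub_distrib, mul_one,
          sum_pathProb H M.s0 (M.isTransition c) (π c), ← mul_div_assoc, ← Finset.sum_div]
        rw [← e1, ← e2]
        ring
      rw [e3, Finset.mul_sum]
      refine Finset.sum_le_sum fun x _ => ?_
      rw [mul_left_comm]
      exact mul_le_mul_of_nonneg_left (mul_le_mul_of_nonneg_left (hexp c x)
        (pathProb_nonneg _ (M.isTransition c) _ _)) (Real.exp_pos _).le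
    refine (Finset.sum_le_sum fun c _ => mul_le_mul_of_nonneg_left (e c) (M.wt_nonneg c)).trans
      (le_of_eq ?_)
    have e2 := sum_mul_affine M.sum_wt (Real.exp (M.dynDev P π / (32 * H))) (-(1 / (32 * H)))
      fun c => M.dynDevAt P c (π c)
    calc _ = _ := Finset.sum_congr rfl fun c _ => by ring
      _ = _ := e2
      _ = _ := by rw [← CMDP.dynDev]; ring

end Episodes

/-! ### Markov's inequality and the union bound -/

section Union

variable {Ω : Type*} [MeasurableSpace Ω]

theorem measure_log_lt_le (μ : Measure Ω) {X : Ω → ℝ} (hX : Measurable X)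
    (hexp : ∫⁻ ω, ENNReal.ofReal (Real.exp (X ω)) ∂μ ≤ 1) {δ : ℝ} (hδ : 0 < δ) :
    μ {ω | Real.log (1 / δ) < X ω} ≤ ENNReal.ofReal δ := by
  have h1 := mul_meas_ge_le_lintegral (μ := μ)
    (f := fun ω => ENNReal.ofReal (Real.exp (X ω))) (by fun_prop) (ENNReal.ofReal (1 / δ))
  have h2 : μ {ω | Real.log (1 / δ) < X ω} ≤
      μ {ω | ENNReal.ofReal (1 / δ) ≤ ENNReal.ofReal (Real.exp (X ω))} := by
    refine measure_mono fun ω hω => ENNReal.ofReal_le_ofReal ?_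
    exact ((Real.log_lt_iff_lt_exp (by positivity)).1 hω).le
  calc μ {ω | Real.log (1 / δ) < X ω}
      = ENNReal.ofReal δ * (ENNReal.ofReal (1 / δ) * μ {ω | Real.log (1 / δ) < X ω}) := by
        rw [← mul_assoc, ← ENNReal.ofReal_mul hδ.le, mul_one_div_cancel hδ.ne',
          ENNReal.ofReal_one, one_mul]
    _ ≤ ENNReal.ofReal δ * 1 := by
        gcongr
        exact (mul_le_mul_right h2 _).trans (h1.trans hexp)
    _ = ENNReal.ofReal δ := mul_one _

theorem le_measure_forall_le_log {ι : Type*} [Fintype ι] (μ : Measure Ω) [IsProbabilityMeasure μ]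
    {X : ι → Ω → ℝ} (hX : ∀ j, Measurable (X j))
    (hexp : ∀ j, ∫⁻ ω, ENNReal.ofReal (Real.exp (X j ω)) ∂μ ≤ 1) {d : ι → ℝ} (hd : ∀ j, 0 < d j)
    {δ : ℝ} (hδ : ∑ j, d j ≤ δ) :
    ENNReal.ofReal (1 - δ) ≤ μ {ω | ∀ j, X j ω ≤ Real.log (1 / d j)} := by
  have hm : MeasurableSet {ω | ∀ j, X j ω ≤ Real.log (1 / d j)} := by
    rw [Set.ofPred_forall]
    exact MeasurableSet.iInter fun j => measurableSet_le (hX j) measurable_const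
  have hc : μ {ω | ∀ j, X j ω ≤ Real.log (1 / d j)}ᶜ ≤ ENNReal.ofReal δ := by
    have : {ω | ∀ j, X j ω ≤ Real.log (1 / d j)}ᶜ = ⋃ j, {ω | Real.log (1 / d j) < X j ω} := by
      ext ω
      simp
    rw [this]
    refine (measure_iUnion_fintype_le _ _).trans ?_
    refine le_trans ?_ (ENNReal.ofReal_le_ofReal hδ)
    rw [ENNReal.ofReal_sum_of_nonneg fun j _ => (hd j).le]
    exact Finset.sum_le_sum fun j _ => measure_log_lt_le μ (hX j) (hexp j) (hd j)
  have h1 := prob_add_prob_compl (μ := μ) hm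
  have hδ0 : 0 ≤ δ := (Finset.sum_nonneg fun j _ => (hd j).le).trans hδ
  rw [ENNReal.ofReal_sub 1 hδ0, ENNReal.ofReal_one, tsub_le_iff_right, ← h1]
  gcongr

end Union

/-! ### The concentration event -/

section Event

variable {C S A : Type*} [Fintype C] [Fintype S] [Fintype A] [DecidableEq S] [DecidableEq A]
  [MeasurableSpace C] [MeasurableSpace S] [MeasurableSpace A] [MeasurableSingletonClass A] {H : ℕ}

/-- The first `t` episodes of a history. -/
def initial {T : ℕ} (σ : Fin T → Traj C S A H) (t : Fin T) : Fin t → Traj C S A H :=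
  fun j => σ (Fin.castLE t.2.le j)

/-- The cutoff `t < n` turns later factors into `1`, so the partial sums of every length are
controlled under the single law of `T` episodes. -/
theorem Alg.lintegral_exp_sum_le_one (𝒜 : Alg C S A H) (M : CMDP C S A H)
    (h : ∀ n, Measurable fun σ : Fin n → Traj C S A H => 𝒜.policy σ)
    (Y : (C → S → A) → Traj C S A H → ℝ) (hY : ∀ π, Measurable (Y π))
    (hle : ∀ π, ∫⁻ τ, ENNReal.ofReal (Real.exp (Y π τ)) ∂(M.episodeLaw π) ≤ 1) (n T : ℕ) :
    (Measurable fun σ : Fin T → Traj C S A H =>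
      ∑ t : Fin T, if (t : ℕ) < n then Y (𝒜.policy (initial σ t)) (σ t) else 0) ∧
    ∫⁻ σ, ENNReal.ofReal (Real.exp
      (∑ t : Fin T, if (t : ℕ) < n then Y (𝒜.policy (initial σ t)) (σ t) else 0))
      ∂(𝒜.historyLaw M T) ≤ 1 := by
  have hY' : Measurable fun p : (C → S → A) × Traj C S A H => Y p.1 p.2 :=
    measurable_from_prod_countable_right hY
  have hm : ∀ t, Measurable fun p : (Fin t → Traj C S A H) × Traj C S A H =>
      if (t : ℕ) < n then Y (𝒜.policy p.1) p.2 else 0 := by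
    intro t
    split_ifs
    · exact hY'.comp (((h t).comp measurable_fst).prodMk measurable_snd)
    · exact measurable_const
  constructor
  · refine Finset.measurable_sum _ fun t _ => ?_
    exact (hm t).comp (by unfold initial; fun_prop : Measurable fun σ : Fin T → Traj C S A H =>
      (initial σ t, σ t))
  · have := 𝒜.lintegral_prod_le_one M h
      (fun t ρ τ => ENNReal.ofReal (Real.exp (if (t : ℕ) < n then Y (𝒜.policy ρ) τ else 0)))
      (fun t => ENNReal.measurable_ofReal.comp (Real.measurable_exp.comp (hm t))) ?_ T
    · refine le_trans (le_of_eq (lintegral_congr fun σ => ?_)) this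
      rw [Real.exp_sum, ENNReal.ofReal_prod_of_nonneg fun t _ => (Real.exp_pos _).le]
      rfl
    · intro t ρ
      split_ifs
      · exact hle _
      · simp

variable [MeasurableSingletonClass C] [MeasurableSingletonClass S]

/-- Simultaneous concentration of the excess losses of all functions of the two classes and of
the regret. -/
theorem Alg.le_historyLaw_concentration (𝒜 : Alg C S A H) (M : CMDP C S A H)
    {F : Finset (C → S → A → ℝ)} {Fp : Finset (C → S → A → S → ℝ)} {πs : C → S → A}
    {δ : ℝ} {T : ℕ} (hH : 1 ≤ H)
    (hF : ∀ f ∈ F, ∀ c s a, f c s a ∈ Set.Icc (0 : ℝ) 1) (hMF : M.meanRew ∈ F)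
    (hP : ∀ P ∈ Fp, ∀ c, IsTransition (P c)) (hMP : M.dyn ∈ Fp)
    (hFo : IsRewOracle F 𝒜.rewOracle) (hPo : IsDynOracle Fp 𝒜.dynOracle)
    (hδ : 0 < δ) (hπs : M.IsOptimal πs) (hT : 1 ≤ T) :
    ENNReal.ofReal (1 - δ) ≤ 𝒜.historyLaw M T {σ |
      (∀ n < T, ∀ f ∈ F, (∑ t : Fin T, if (t : ℕ) < n then
        (M.rewDev f (𝒜.policy (initial σ t)) / (16 * H) - M.rewGap f (σ t) / (8 * H)) else 0) ≤
          Real.log (3 * T * F.card / δ)) ∧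
      (∀ n < T, ∀ P ∈ Fp, (∑ t : Fin T, if (t : ℕ) < n then
        (M.dynDev P (𝒜.policy (initial σ t)) / (32 * H) - M.dynGap P (σ t) / (16 * H)) else 0) ≤
          Real.log (3 * T * Fp.card / δ)) ∧
      𝒜.regret M πs σ / H - 2 * (∑ t : Fin T, M.meanRegret πs (𝒜.policy (initial σ t))) / H ≤
        Real.log (3 / δ)} := by
  have hpol := 𝒜.measurable_policy hFo hPo
  have hcF : (0 : ℝ) < F.card := by exact_mod_cast Finset.card_pos.2 ⟨_, hMF⟩
  have hcP : (0 : ℝ) < Fp.card := by exact_mod_cast Finset.card_pos.2 ⟨_, hMP⟩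
  have hT' : (0 : ℝ) < T := by exact_mod_cast hT
  have : IsProbabilityMeasure (𝒜.historyLaw M T) := ⟨𝒜.historyLaw_univ M hpol T⟩
  -- The index `n` ranges over the lengths of history on which estimates are computed. Uniformity
  -- over the classes is needed because the estimates depend on the data. Each of the three families
  -- receives failure probability `δ/3`.
  let X : (Fin T × F) ⊕ (Fin T × Fp) ⊕ Unit → (Fin T → Traj C S A H) → ℝ :=
    Sum.elim
      (fun j σ => ∑ t : Fin T, if (t : ℕ) < (j.1 : ℕ) then
        (M.rewDev j.2 (𝒜.policy (initial σ t)) / (16 * H) - M.rewGap j.2 (σ t) / (8 * H)) else 0)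
      (Sum.elim
        (fun j σ => ∑ t : Fin T, if (t : ℕ) < (j.1 : ℕ) then
          (M.dynDev j.2 (𝒜.policy (initial σ t)) / (32 * H) - M.dynGap j.2 (σ t) / (16 * H))
          else 0)
        (fun _ σ => ∑ t : Fin T, if (t : ℕ) < T then
          ((M.val (σ t).1 (πs (σ t).1) - M.val (σ t).1 (𝒜.policy (initial σ t) (σ t).1)) / H -
            2 * M.meanRegret πs (𝒜.policy (initial σ t)) / H) else 0))
  let d : (Fin T × F) ⊕ (Fin T × Fp) ⊕ Unit → ℝ :=
    Sum.elim (fun _ => δ / (3 * T * F.card)) (Sum.elim (fun _ => δ / (3 * T * Fp.card))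
      fun _ => δ / 3)
  have hX : ∀ j, Measurable (X j) ∧
      ∫⁻ σ, ENNReal.ofReal (Real.exp (X j σ)) ∂(𝒜.historyLaw M T) ≤ 1 := by
    rintro (⟨n, f⟩ | ⟨n, P⟩ | _)
    · have hm := M.measurable_rewGap f.1
      exact 𝒜.lintegral_exp_sum_le_one M hpol
        (fun π τ => M.rewDev f π / (16 * H) - M.rewGap f τ / (8 * H)) (fun π => by fun_prop)
        (fun π => M.lintegral_exp_rewGap_le hH (hF f f.2) (hF _ hMF) π) n T
    · have hm := M.measurable_dynGap P.1
      exact 𝒜.lintegral_exp_sum_le_one M hpol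
        (fun π τ => M.dynDev P π / (32 * H) - M.dynGap P τ / (16 * H)) (fun π => by fun_prop)
        (fun π => M.lintegral_exp_dynGap_le hH (hP P P.2) π) n T
    · refine 𝒜.lintegral_exp_sum_le_one M hpol
        (fun π τ => (M.val τ.1 (πs τ.1) - M.val τ.1 (π τ.1)) / H - 2 * M.meanRegret πs π / H)
        (fun π => ?_) (fun π => M.lintegral_exp_regret_le hH (hF _ hMF) hπs π) T T
      have hR : Measurable fun c => M.val c (πs c) - M.val c (π c) := measurable_of_finite _
      exact ((hR.comp measurable_fst).div_const _).sub_const _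
  have hd : ∀ j, 0 < d j := by
    rintro (_ | _ | _) <;> simp only [d, Sum.elim_inl, Sum.elim_inr] <;> positivity
  have hsum : ∑ j, d j ≤ δ := by
    simp only [d, Fintype.sum_sum_type, Sum.elim_inl, Sum.elim_inr, Finset.sum_const,
      Finset.card_univ, Fintype.card_prod, Fintype.card_fin, Fintype.card_coe, nsmul_eq_mul,
      Fintype.card_unit, Nat.cast_mul, Nat.cast_one]
    apply le_of_eq
    field_simp
    norm_num
  refine (le_measure_forall_le_log _ (fun j => (hX j).1) (fun j => (hX j).2) hd hsum).trans
    (measure_mono fun σ hσ => ⟨fun n hn f hf => ?_, fun n hn P hP => ?_, ?_⟩)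
  · have := hσ (Sum.inl (⟨n, hn⟩, ⟨f, hf⟩))
    simpa only [X, d, Sum.elim_inl, one_div_div] using this
  · have := hσ (Sum.inr (Sum.inl (⟨n, hn⟩, ⟨P, hP⟩)))
    simpa only [X, d, Sum.elim_inl, Sum.elim_inr, one_div_div] using this
  · have := hσ (Sum.inr (Sum.inr ()))
    simp only [X, d, Sum.elim_inr, one_div_div, Fin.is_lt, if_true, Finset.sum_sub_distrib,
      ← Finset.sum_div, ← Finset.mul_sum] at this
    rw [← Finset.sum_sub_distrib] at this
    exact this

end Event

/-! ### Sums of inverse counts -/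

section Counting

theorem sum_range_inv_le {m T : ℕ} (hm : m ≤ T) :
    ∑ k ∈ Finset.range m, (k : ℝ)⁻¹ ≤ 1 + Real.log T := by
  have hlog : 0 ≤ Real.log T := Real.log_natCast_nonneg T
  cases m with
  | zero =>
    simp only [Finset.range_zero, Finset.sum_empty]
    linarith
  | succ m =>
    rw [Finset.sum_range_succ']
    have h1 := harmonic_le_one_add_log m
    have h2 : ((harmonic m : ℚ) : ℝ) = ∑ k ∈ Finset.range m, ((k + 1 : ℕ) : ℝ)⁻¹ := by
      simp [harmonic]
    rw [h2] at h1
    have h3 : Real.log m ≤ Real.log T := by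
      rcases Nat.eq_zero_or_pos m with rfl | hm0
      · simpa using hlog
      · exact Real.log_le_log (by exact_mod_cast hm0) (by exact_mod_cast (by omega : m ≤ T))
    simp only [Nat.cast_zero, inv_zero, add_zero]
    linarith

/-- Group the rounds by the action played: a play preceded by `k` plays of the same action
contributes `1/k`. The first play contributes `0⁻¹ = 0`. -/
theorem sum_inv_count_eq {A : Type*} [Fintype A] [DecidableEq A] (u : ℕ → A) (T : ℕ) :
    ∑ n ∈ Finset.range T, (((Finset.range n).filter fun i => u n = u i).card : ℝ)⁻¹ =
      ∑ a, ∑ k ∈ Finset.range ((Finset.range T).filter fun i => a = u i).card, (k : ℝ)⁻¹ := by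
  induction T with
  | zero => simp
  | succ T ih =>
    rw [Finset.sum_range_succ, ih]
    have h : ∀ a, ∑ k ∈ Finset.range ((Finset.range (T + 1)).filter fun i => a = u i).card,
        (k : ℝ)⁻¹ = ∑ k ∈ Finset.range ((Finset.range T).filter fun i => a = u i).card, (k : ℝ)⁻¹ +
          if a = u T then (((Finset.range T).filter fun i => a = u i).card : ℝ)⁻¹ else 0 := by
      intro a
      rw [Finset.range_add_one, Finset.filter_insert]
      split_ifs with ha
      · rw [Finset.card_insert_of_notMem (by simp), Finset.sum_range_succ]
      · simp
    simp_rw [h, Finset.sum_add_distrib]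
    simp

/-- The inverse counts of the actions played before, summed over the rounds. -/
theorem sum_inv_count_le {A : Type*} [Fintype A] [DecidableEq A] {T : ℕ} (hT : 1 ≤ T)
    (u : Fin T → A) :
    ∑ t : Fin T, (∑ i : Fin t, if u t = u (Fin.castLE t.2.le i) then (1 : ℝ) else 0)⁻¹ ≤
      Fintype.card A * (1 + Real.log T) := by
  have : Nonempty A := ⟨u ⟨0, hT⟩⟩
  let v : ℕ → A := fun n => if h : n < T then u ⟨n, h⟩ else Classical.arbitrary A
  have hv : ∀ (n : ℕ) (h : n < T), v n = u ⟨n, h⟩ := fun n h => dif_pos h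
  calc ∑ t : Fin T, (∑ i : Fin t, if u t = u (Fin.castLE t.2.le i) then (1 : ℝ) else 0)⁻¹
      = ∑ t : Fin T, (((Finset.range t).filter fun i => v t = v i).card : ℝ)⁻¹ := by
        refine Finset.sum_congr rfl fun t _ => ?_
        rw [Finset.card_filter, Nat.cast_sum,
          ← Fin.sum_univ_eq_sum_range (fun i => ((if v t = v i then 1 else 0 : ℕ) : ℝ))]
        congr 1
        refine Finset.sum_congr rfl fun i _ => ?_
        rw [hv t t.2, hv i (i.2.trans t.2)]
        simp only [Nat.cast_ite, Nat.cast_one, Nat.cast_zero]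
        rfl
    _ = ∑ a, ∑ k ∈ Finset.range ((Finset.range T).filter fun i => a = v i).card, (k : ℝ)⁻¹ := by
        rw [← sum_inv_count_eq,
          Fin.sum_univ_eq_sum_range
            (fun n => (((Finset.range n).filter fun i => v n = v i).card : ℝ)⁻¹)]
    _ ≤ ∑ _a : A, (1 + Real.log T) := Finset.sum_le_sum fun a _ => sum_range_inv_le
        ((Finset.card_filter_le _ _).trans (by simp))
    _ = Fintype.card A * (1 + Real.log T) := by simp [Finset.card_univ, mul_add]

theorem sum_ite_lt_eq {n T : ℕ} (hn : n ≤ T) (φ : Fin T → ℝ) :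
    (∑ t : Fin T, if (t : ℕ) < n then φ t else 0) = ∑ i : Fin n, φ (Fin.castLE hn i) := by
  refine (Fintype.sum_of_injective (Fin.castLE hn) (Fin.castLE_injective hn) _ _ ?_ ?_).symm
  · intro t ht
    refine if_neg fun h => ht ⟨⟨t, h⟩, rfl⟩
  · intro i
    simp

end Counting

/-! ### Unfolding the algorithm -/

section Algorithm

variable {C S A : Type*} [Fintype S] [Fintype A] [DecidableEq A] {H : ℕ}

/-- The recursion looks only backwards. Hence the policies recomputed from the full history are
those actually played, and the default value `0` in `Alg.policy` is irrelevant. -/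
theorem Alg.policySeq_congr (𝒜 : Alg C S A H) {f f' : ℕ → C → S → A → ℝ}
    {P P' : ℕ → C → S → A → S → ℝ} (c : C) (n : ℕ) (hf : ∀ i ≤ n, f i = f' i)
    (hP : ∀ i ≤ n, P i = P' i) : 𝒜.policySeq f P c n = 𝒜.policySeq f' P' c n := by
  induction n using Nat.strong_induction_on with
  | _ n ih =>
    rw [Alg.policySeq, Alg.policySeq]
    split_ifs with hn
    · rfl
    · have h : ∀ i : Fin n, 𝒜.policySeq f P c i = 𝒜.policySeq f' P' c i := fun i =>
        ih i i.2 (fun j hj => hf j (hj.trans i.2.le)) (fun j hj => hP j (hj.trans i.2.le))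
      simp only [h, hf n le_rfl, hP n le_rfl]

/-- Number of earlier rounds in which the policy chose `a` in the context `c` and state `s`. -/
def Alg.count (𝒜 : Alg C S A H) {n : ℕ} (ρ : Fin n → Traj C S A H) (c : C) (s : S) (a : A) : ℝ :=
  ∑ i : Fin n, if a = 𝒜.policy (initial ρ i) c s then (1 : ℝ) else 0

theorem Alg.policy_of_lt (𝒜 : Alg C S A H) {n : ℕ} (ρ : Fin n → Traj C S A H) (c : C) (s : S)
    (hn : n < Fintype.card A) : 𝒜.policy ρ c s = 𝒜.enum ⟨n, hn⟩ := by
  rw [Alg.policy, Alg.policySeq, dif_pos hn]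

theorem Alg.policy_of_ge (𝒜 : Alg C S A H) {n : ℕ} (ρ : Fin n → Traj C S A H) (c : C)
    (hn : Fintype.card A ≤ n) :
    𝒜.policy ρ c = 𝒜.plan (𝒜.dynOracle n ρ c) fun s a => 𝒜.rewOracle n ρ c s a +
      (𝒜.β (n + 1) + H * Fintype.card S * 𝒜.γ (n + 1)) / (𝒜.pmin * 𝒜.count ρ c s a) := by
  have h : ∀ i : Fin n, 𝒜.policySeq
      (fun i => if hi : i ≤ n then 𝒜.rewOracle i (fun j => ρ (Fin.castLE hi j)) else 0)
      (fun i => if hi : i ≤ n then 𝒜.dynOracle i (fun j => ρ (Fin.castLE hi j)) else 0) c i =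
      𝒜.policy (initial ρ i) c := by
    intro i
    refine 𝒜.policySeq_congr c i (fun j hj => ?_) fun j hj => ?_
    · rw [dif_pos hj, dif_pos (hj.trans i.2.le)]
      rfl
    · rw [dif_pos hj, dif_pos (hj.trans i.2.le)]
      rfl
  rw [Alg.policy, Alg.policySeq, dif_neg (by omega)]
  simp only [h, dif_pos le_rfl]
  rfl

/-- The initial phase plays each action once in every context and state, which keeps the
denominators of the bonuses positive. -/
theorem Alg.one_le_count (𝒜 : Alg C S A H) {n : ℕ} (ρ : Fin n → Traj C S A H) (c : C) (s : S)
    (a : A) (hn : Fintype.card A ≤ n) : 1 ≤ 𝒜.count ρ c s a := by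
  let i : Fin n := ⟨𝒜.enum.symm a, (𝒜.enum.symm a).2.trans_le hn⟩
  have hi : a = 𝒜.policy (initial ρ i) c s := by
    rw [𝒜.policy_of_lt (initial ρ i) c s (𝒜.enum.symm a).2]
    exact (𝒜.enum.apply_symm_apply a).symm
  unfold Alg.count
  refine le_trans (le_of_eq ?_) (Finset.single_le_sum
    (f := fun i => if a = 𝒜.policy (initial ρ i) c s then (1 : ℝ) else 0)
    (fun j _ => by split_ifs <;> norm_num) (Finset.mem_univ i))
  simp [← hi]

end Algorithm

/-! ### Regret of one round -/

section Round

theorem abs_le_div_add_mul_sq {b x : ℝ} (hb : 0 < b) (hx : 0 < x) (d : ℝ) :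
    |d| ≤ b / x + x * d ^ 2 / (4 * b) := by
  rw [div_add_div _ _ hx.ne' (by positivity), le_div_iff₀ (by positivity), ← sq_abs d]
  nlinarith [sq_nonneg (2 * b - x * |d|)]

/-- AM-GM with parameter `|S| g`: the factor `|S|` from Cauchy-Schwarz then cancels in the quadratic
term and appears only in the bonus, which explains `H |S| γ_t`. -/
theorem sum_abs_le_div_add_mul_sum_sq {S : Type*} [Fintype S] [Nonempty S] {g x : ℝ} (hg : 0 < g)
    (hx : 0 < x) (d : S → ℝ) :
    ∑ s, |d s| ≤ Fintype.card S * g / x + x * (∑ s, d s ^ 2) / (4 * g) := by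
  have hS : (0 : ℝ) < Fintype.card S := by exact_mod_cast Fintype.card_pos
  have h1 := (le_abs_self _).trans
    (abs_le_div_add_mul_sq (mul_pos hS hg) hx (∑ s, |d s|))
  have h2 : (∑ s, |d s|) ^ 2 ≤ Fintype.card S * ∑ s, d s ^ 2 := by
    refine (sq_sum_le_card_mul_sum_sq (s := Finset.univ) (f := fun s => |d s|)).trans ?_
    simp [Finset.card_univ]
  refine h1.trans (add_le_add_right ?_ _)
  calc x * (∑ s, |d s|) ^ 2 / (4 * (Fintype.card S * g))
      ≤ x * (Fintype.card S * ∑ s, d s ^ 2) / (4 * (Fintype.card S * g)) := by gcongr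
    _ = x * (∑ s, d s ^ 2) / (4 * g) := by field_simp

variable {C S A : Type*} [Fintype S] [Fintype A] [DecidableEq S] [DecidableEq A] {H : ℕ}

/-- The squared errors of the visited pairs, weighted by the counts, are dominated by the expected
squared errors along the episodes played so far. -/
theorem Alg.sum_count_mul_le (𝒜 : Alg C S A H) (M : CMDP C S A H) (hp : 0 < 𝒜.pmin)
    (hreach : M.MinReach 𝒜.pmin) {n : ℕ} (ρ : Fin n → Traj C S A H) (c : C) {g : S → A → ℝ}
    (hg : ∀ s a, 0 ≤ g s a) (π : S → A) :
    ∑ s ∈ Finset.univ.erase M.sH, 𝒜.pmin * 𝒜.count ρ c s (π s) * g s (π s) ≤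
      ∑ i : Fin n, value H M.s0 (M.dyn c) g (𝒜.policy (initial ρ i) c) := by
  calc ∑ s ∈ Finset.univ.erase M.sH, 𝒜.pmin * 𝒜.count ρ c s (π s) * g s (π s)
      = ∑ i : Fin n, 𝒜.pmin * ∑ s ∈ Finset.univ.erase M.sH,
          if π s = 𝒜.policy (initial ρ i) c s then g s (π s) else 0 := by
        simp_rw [Alg.count, Finset.mul_sum, Finset.sum_mul]
        rw [Finset.sum_comm]
        refine Finset.sum_congr rfl fun i _ => Finset.sum_congr rfl fun s _ => ?_
        split_ifs <;> simp
    -- Where policy `i` agrees with `π` the terms coincide; elsewhere a nonnegative term is added.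
    -- The comparison therefore holds for an arbitrary `π`, including an optimal one.
    _ ≤ ∑ i : Fin n, 𝒜.pmin * ∑ s ∈ Finset.univ.erase M.sH,
          g s (𝒜.policy (initial ρ i) c s) := by
        refine Finset.sum_le_sum fun i _ =>
          mul_le_mul_of_nonneg_left (Finset.sum_le_sum fun s _ => ?_) hp.le
        split_ifs with h
        · rw [h]
        · exact hg _ _
    _ ≤ _ := Finset.sum_le_sum fun i _ =>
        mul_sum_le_value (M.isTransition c) (M.isLayering c) hg fun s => hreach c _ s

/-- Regret of one round in one context, in terms of the bonuses and the estimation errors. -/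
theorem Alg.regret_round_le (𝒜 : Alg C S A H) (M : CMDP C S A H) (hp : 0 < 𝒜.pmin)
    (hreach : M.MinReach 𝒜.pmin) (hM : ∀ c s a, M.meanRew c s a ∈ Set.Icc (0 : ℝ) 1)
    (hplan : IsPlanner H M.s0 𝒜.plan) {n : ℕ} (ρ : Fin n → Traj C S A H) (c : C)
    (hn : Fintype.card A ≤ n)
    (hP : IsTransition (𝒜.dynOracle n ρ c) ∧ ∃ layer : S → Fin (H + 1),
      IsLayering M.s0 M.sH (𝒜.dynOracle n ρ c) layer)
    (hβ : 0 < 𝒜.β (n + 1)) (hγ : 0 < 𝒜.γ (n + 1)) (π : S → A) :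
    M.val c π - M.val c (𝒜.policy ρ c) ≤
      2 * (∑ s, (𝒜.β (n + 1) + H * Fintype.card S * 𝒜.γ (n + 1)) / 𝒜.pmin *
        (𝒜.count ρ c s (𝒜.policy ρ c s))⁻¹) +
      2 * ((∑ i : Fin n, M.rewDevAt (𝒜.rewOracle n ρ) c (𝒜.policy (initial ρ i) c)) /
          (4 * 𝒜.β (n + 1)) +
        H * (∑ i : Fin n, M.dynDevAt (𝒜.dynOracle n ρ) c (𝒜.policy (initial ρ i) c)) /
          (4 * 𝒜.γ (n + 1))) := by
  have : Nonempty S := ⟨M.s0⟩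
  obtain ⟨hPt, layer, hPl⟩ := hP
  set f := 𝒜.rewOracle n ρ with hf
  set P := 𝒜.dynOracle n ρ with hPd
  set β := 𝒜.β (n + 1)
  set γ := 𝒜.γ (n + 1)
  -- For non-final `s`, a lower bound for the expected number of visits to `(s,a)` had all earlier
  -- rounds had context `c`.
  let x : S → A → ℝ := fun s a => 𝒜.pmin * 𝒜.count ρ c s a
  have hx : ∀ s a, 0 < x s a := fun s a =>
    mul_pos hp (one_pos.trans_le (𝒜.one_le_count ρ c s a hn))
  let b : S → A → ℝ := fun s a => (β + H * Fintype.card S * γ) / x s a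
  have hb : ∀ s a, 0 ≤ b s a := fun s a => div_nonneg (by positivity) (hx s a).le
  let df : S → A → ℝ := fun s a => (f c s a - M.meanRew c s a) ^ 2
  let dp : S → A → ℝ := fun s a => ∑ s', (P c s a s' - M.dyn c s a s') ^ 2
  have hdf : ∀ s a, 0 ≤ df s a := fun s a => sq_nonneg _
  have hdp : ∀ s a, 0 ≤ dp s a := fun s a => Finset.sum_nonneg fun _ _ => sq_nonneg _
  let e : S → A → ℝ := fun s a => x s a * df s a / (4 * β) + H * (x s a * dp s a / (4 * γ))
  have he : ∀ s a, 0 ≤ e s a := by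
    intro s a
    have := (hx s a).le
    have := hdf s a
    have := hdp s a
    positivity
  have hpt : ∀ s a, |f c s a - M.meanRew c s a| + H * ∑ s', |P c s a s' - M.dyn c s a s'| ≤
      b s a + e s a := by
    intro s a
    have h1 := abs_le_div_add_mul_sq hβ (hx s a) (f c s a - M.meanRew c s a)
    have h2 := mul_le_mul_of_nonneg_left (sum_abs_le_div_add_mul_sum_sq hγ (hx s a)
      fun s' => P c s a s' - M.dyn c s a s') (Nat.cast_nonneg (α := ℝ) H)
    have h3 : b s a = β / x s a + H * (Fintype.card S * γ / x s a) := by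
      simp only [b]
      ring
    simp only [e, h3]
    simp only [df, dp]
    linarith
  have hE : ∀ π' : S → A, ∑ s ∈ Finset.univ.erase M.sH, e s (π' s) ≤
      (∑ i : Fin n, M.rewDevAt f c (𝒜.policy (initial ρ i) c)) / (4 * β) +
        H * (∑ i : Fin n, M.dynDevAt P c (𝒜.policy (initial ρ i) c)) / (4 * γ) := by
    intro π'
    simp only [e, Finset.sum_add_distrib, ← Finset.mul_sum, ← Finset.sum_div]
    rw [mul_div_assoc]
    gcongr
    · exact 𝒜.sum_count_mul_le M hp hreach ρ c hdf π'
    · exact 𝒜.sum_count_mul_le M hp hreach ρ c hdp π'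
  -- Optimism up to `e`: the bonus cancels the first part of the pointwise error. `value_le_sum`
  -- uses the layering of the estimated dynamics, whose layers may differ from the true ones.
  have hopt : M.val c π - value H M.s0 (P c) (fun s a => f c s a + b s a) π ≤
      ∑ s ∈ Finset.univ.erase M.sH, e s (π s) := by
    refine (value_sub_value_ge H le_rfl M.s0 hPt (M.isTransition c) (fun s a => (hM c s a).1)
      (fun s a => (hM c s a).2) π).trans (value_le_sum hPt hPl (fun s => he _ _) fun s _ => ?_)
    have := hpt s (π s)
    have := neg_abs_le (f c s (π s) - M.meanRew c s (π s))
    linarith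
  have hpol : 𝒜.policy ρ c = 𝒜.plan (P c) fun s a => f c s a + b s a := 𝒜.policy_of_ge ρ c hn
  have hpl : value H M.s0 (P c) (fun s a => f c s a + b s a) π ≤
      value H M.s0 (P c) (fun s a => f c s a + b s a) (𝒜.policy ρ c) := by
    rw [hpol]
    exact hplan _ _ _
  set π' := 𝒜.policy ρ c
  have hest : value H M.s0 (P c) (fun s a => f c s a + b s a) π' - M.val c π' ≤
      ∑ s ∈ Finset.univ.erase M.sH, (2 * b s (π' s) + e s (π' s)) := by
    refine (value_sub_value_le H le_rfl M.s0 hPt (M.isTransition c) (fun s a => (hM c s a).1)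
      (fun s a => (hM c s a).2) π').trans (value_le_sum hPt hPl
        (fun s => add_nonneg (mul_nonneg two_pos.le (hb _ _)) (he _ _)) fun s _ => ?_)
    have := hpt s (π' s)
    have := le_abs_self (f c s (π' s) - M.meanRew c s (π' s))
    linarith
  have hbs : ∑ s ∈ Finset.univ.erase M.sH, b s (π' s) ≤
      ∑ s, (β + H * Fintype.card S * γ) / 𝒜.pmin * (𝒜.count ρ c s (π' s))⁻¹ := by
    refine (Finset.sum_le_sum_of_subset_of_nonneg (Finset.erase_subset _ _)
      fun s _ _ => hb _ _).trans (le_of_eq (Finset.sum_congr rfl fun s _ => ?_))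
    simp only [b, x]
    rw [← div_div, div_eq_mul_inv]
  rw [Finset.sum_add_distrib, ← Finset.mul_sum] at hest
  have h1 := hE π
  have h2 := hE π'
  linarith

end Round

/-! ### Tuning parameters and logarithms -/

section Parameters

theorem one_le_logp (x : ℝ) : 1 ≤ logp x := le_max_left _ _

theorem log_le_logp (x : ℝ) : Real.log x ≤ logp x := le_max_right _ _

theorem logp_le_logp {x y : ℝ} (hx : 0 < x) (hxy : x ≤ y) : logp x ≤ logp y :=
  max_le_max le_rfl (Real.log_le_log hx hxy)

theorem log_three_mul_div_le {N T : ℕ} (hN : 1 ≤ N) (hT : 1 ≤ T) {δ : ℝ} (hδ : 0 < δ) :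
    Real.log (3 * T * N / δ) ≤ 3 * (1 + Real.log T) * logp (N / δ) := by
  have hN' : (0 : ℝ) < N := by exact_mod_cast hN
  have hT' : (0 : ℝ) < T := by exact_mod_cast hT
  have h3 : Real.log 3 ≤ 2 := by
    have := Real.log_le_sub_one_of_pos (by norm_num : (0 : ℝ) < 3)
    linarith
  rw [mul_div_assoc, Real.log_mul (by positivity) (by positivity),
    Real.log_mul (by norm_num) hT'.ne']
  have h1 := one_le_logp (N / δ)
  have h2 := log_le_logp (N / δ)
  have h4 : 0 ≤ Real.log T := Real.log_natCast_nonneg T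
  nlinarith

/-- Lets the deviation of the realized regret be charged to the logarithm of the dynamics class. -/
theorem log_three_div_le {N : ℕ} (hN : 1 ≤ N) {δ : ℝ} (hδ : 0 < δ) :
    Real.log (3 / δ) ≤ 3 * logp (N / δ) := by
  have h := log_three_mul_div_le hN le_rfl hδ
  simp only [Nat.cast_one, mul_one, Real.log_one, add_zero] at h
  refine (Real.log_le_log (by positivity) ?_).trans h
  have hN' : (1 : ℝ) ≤ N := by exact_mod_cast hN
  gcongr
  linarith

/-- The factor `8` contributes `3 log 2 > 1`, so the logarithm dominates `logp`. Above, it is at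
most `4(1 + log T) logp`, and `25 · 4 = 10²`, with `25` a common ceiling for `17` and `18`. -/
theorem sqrt_param_bounds {N t T : ℕ} (hN : 1 ≤ N) (ht : 1 ≤ t) (htT : t ≤ T) {δ a κ : ℝ}
    (hδ : 0 < δ) (hδ1 : δ < 1) (ha : 0 < a) (hκ : 1 ≤ κ) (hκ' : κ ≤ 25) :
    √(t * logp (N / δ) / a) ≤ √(κ * t * Real.log (8 * N * (t : ℝ) ^ 3 / δ) / a) ∧
    √(κ * t * Real.log (8 * N * (t : ℝ) ^ 3 / δ) / a) ≤
      10 * (1 + Real.log T) * √(T * logp (N / δ) / a) := by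
  have hN' : (1 : ℝ) ≤ N := by exact_mod_cast hN
  have ht' : (1 : ℝ) ≤ t := by exact_mod_cast ht
  have htT' : (t : ℝ) ≤ T := by exact_mod_cast htT
  have e : Real.log (8 * N * (t : ℝ) ^ 3 / δ) =
      3 * Real.log 2 + 3 * Real.log t + Real.log (N / δ) := by
    rw [show 8 * N * (t : ℝ) ^ 3 / δ = 2 ^ 3 * (t : ℝ) ^ 3 * (N / δ) by ring,
      Real.log_mul (by positivity) (by positivity), Real.log_mul (by positivity) (by positivity),
      Real.log_pow, Real.log_pow]
    push_cast
    ring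
  have h2a := Real.log_two_gt_d9
  have h2b := Real.log_two_lt_d9
  have hlt : 0 ≤ Real.log t := Real.log_nonneg ht'
  have hlT : Real.log t ≤ Real.log T := Real.log_le_log (by linarith) htT'
  have hl0 : 0 ≤ Real.log (N / δ) := Real.log_nonneg (by rw [le_div_iff₀ hδ]; linarith)
  have hl1 := one_le_logp (N / δ)
  have hl2 := log_le_logp (N / δ)
  have hl3 : logp (N / δ) ≤ 1 + Real.log (N / δ) := max_le (by linarith) (by linarith)
  rw [e]
  constructor
  · refine Real.sqrt_le_sqrt (div_le_div_of_nonneg_right ?_ ha.le)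
    have h5 : (t : ℝ) * logp (N / δ) ≤
        t * (3 * Real.log 2 + 3 * Real.log t + Real.log (N / δ)) :=
      mul_le_mul_of_nonneg_left (by linarith) (by linarith)
    refine h5.trans ?_
    rw [mul_assoc]
    exact le_mul_of_one_le_left (by positivity) hκ
  · rw [Real.sqrt_le_left (by positivity), mul_pow, Real.sq_sqrt (by positivity), ← mul_div_assoc]
    refine div_le_div_of_nonneg_right ?_ ha.le
    have h5 : 3 * Real.log 2 + 3 * Real.log t + Real.log (N / δ) ≤
        4 * (1 + Real.log T) * logp (N / δ) := by nlinarith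
    have h6 : 4 * (1 + Real.log T) * logp (N / δ) ≤ 4 * (1 + Real.log T) ^ 2 * logp (N / δ) := by
      gcongr
      nlinarith
    calc κ * t * (3 * Real.log 2 + 3 * Real.log t + Real.log (N / δ))
        ≤ 25 * T * (4 * (1 + Real.log T) ^ 2 * logp (N / δ)) := by
          gcongr
          exact h5.trans h6
      _ = (10 * (1 + Real.log T)) ^ 2 * (T * logp (N / δ)) := by ring

theorem div_sqrt_mul_div {l t a : ℝ} (hl : 0 < l) (ht : 0 < t) (ha : 0 < a) :
    l / √(t * l / a) = √(a * l) * (√t)⁻¹ := by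
  rw [Real.sqrt_div (by positivity), Real.sqrt_mul ht.le, Real.sqrt_mul ha.le]
  have h1 := Real.sqrt_pos.2 hl
  have h2 := Real.sqrt_pos.2 ht
  have h3 := Real.sqrt_pos.2 ha
  field_simp
  exact (Real.sq_sqrt hl.le).symm

theorem sum_inv_sqrt_le (T : ℕ) : ∑ t : Fin T, (√((t : ℕ) + 1 : ℝ))⁻¹ ≤ 2 * √T := by
  rw [Fin.sum_univ_eq_sum_range (fun n => (√((n : ℝ) + 1))⁻¹)]
  induction T with
  | zero => simp
  | succ T ih =>
    rw [Finset.sum_range_succ]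
    push_cast
    have h1 : 0 < √((T : ℝ) + 1) := Real.sqrt_pos.2 (by positivity)
    have h2 : √((T : ℝ) + 1) ^ 2 = T + 1 := Real.sq_sqrt (by positivity)
    have h3 : √(T : ℝ) ^ 2 = T := Real.sq_sqrt (by positivity)
    have h4 : (√((T : ℝ) + 1))⁻¹ ≤ 2 * (√((T : ℝ) + 1) - √T) := by
      rw [inv_le_iff_one_le_mul₀ h1]
      nlinarith [sq_nonneg (√((T : ℝ) + 1) - √T)]
    linarith

end Parameters

/-! ### Summation over rounds -/

section Sum

/-- For fixed `(c,s)` the actions `π_t(c;s)` form one sequence over all rounds, whether or not `c`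
is drawn. Exchanging the sums lets `sum_inv_count_le` apply to each of them. -/
theorem Alg.sum_count_inv_le {C S A : Type*} [Fintype C] [Fintype S] [Fintype A] [DecidableEq A]
    {H : ℕ} (𝒜 : Alg C S A H) (M : CMDP C S A H) {T : ℕ} (hT : 1 ≤ T)
    (σ : Fin T → Traj C S A H) :
    ∑ t : Fin T, ∑ c, M.wt c *
      ∑ s, (𝒜.count (initial σ t) c s (𝒜.policy (initial σ t) c s))⁻¹ ≤
      Fintype.card S * (Fintype.card A * (1 + Real.log T)) := by
  rw [Finset.sum_comm]
  calc ∑ c, ∑ t : Fin T, M.wt c *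
      ∑ s, (𝒜.count (initial σ t) c s (𝒜.policy (initial σ t) c s))⁻¹
      = ∑ c, M.wt c * ∑ s, ∑ t : Fin T,
          (𝒜.count (initial σ t) c s (𝒜.policy (initial σ t) c s))⁻¹ := by
        refine Finset.sum_congr rfl fun c _ => ?_
        rw [← Finset.mul_sum, Finset.sum_comm]
    _ ≤ ∑ c, M.wt c * ∑ _s : S, Fintype.card A * (1 + Real.log T) := by
        refine Finset.sum_le_sum fun c _ => mul_le_mul_of_nonneg_left
          (Finset.sum_le_sum fun s _ => ?_) (M.wt_nonneg c)
        exact sum_inv_count_le hT fun t : Fin T => 𝒜.policy (initial σ t) c s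
    _ = _ := by
        rw [← Finset.sum_mul, M.sum_wt, one_mul, Finset.sum_const, Finset.card_univ, nsmul_eq_mul]

variable {C S A : Type*} [Fintype C] [Fintype S] [Fintype A] [DecidableEq S] [DecidableEq A]
  {H : ℕ}

theorem Alg.meanRegret_le (𝒜 : Alg C S A H) (M : CMDP C S A H) (hp : 0 < 𝒜.pmin)
    (hreach : M.MinReach 𝒜.pmin) (hM : ∀ c s a, M.meanRew c s a ∈ Set.Icc (0 : ℝ) 1)
    (hplan : IsPlanner H M.s0 𝒜.plan) {n : ℕ} (ρ : Fin n → Traj C S A H)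
    (hn : Fintype.card A ≤ n)
    (hP : ∀ c, IsTransition (𝒜.dynOracle n ρ c) ∧ ∃ layer : S → Fin (H + 1),
      IsLayering M.s0 M.sH (𝒜.dynOracle n ρ c) layer)
    (hβ : 0 < 𝒜.β (n + 1)) (hγ : 0 < 𝒜.γ (n + 1)) (πs : C → S → A) :
    M.meanRegret πs (𝒜.policy ρ) ≤
      2 * ((𝒜.β (n + 1) + H * Fintype.card S * 𝒜.γ (n + 1)) / 𝒜.pmin *
        ∑ c, M.wt c * ∑ s, (𝒜.count ρ c s (𝒜.policy ρ c s))⁻¹) +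
      2 * ((∑ i : Fin n, M.rewDev (𝒜.rewOracle n ρ) (𝒜.policy (initial ρ i))) /
          (4 * 𝒜.β (n + 1)) +
        H * (∑ i : Fin n, M.dynDev (𝒜.dynOracle n ρ) (𝒜.policy (initial ρ i))) /
          (4 * 𝒜.γ (n + 1))) := by
  refine (Finset.sum_le_sum fun c _ => mul_le_mul_of_nonneg_left
    (𝒜.regret_round_le M hp hreach hM hplan ρ c hn (hP c) hβ hγ (πs c))
    (M.wt_nonneg c)).trans (le_of_eq ?_)
  simp only [CMDP.rewDev, CMDP.dynDev]
  rw [Finset.sum_comm (f := fun (i : Fin n) c => M.wt c * M.rewDevAt _ c _),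
    Finset.sum_comm (f := fun (i : Fin n) c => M.wt c * M.dynDevAt _ c _)]
  simp only [mul_add, Finset.sum_add_distrib, Finset.mul_sum, Finset.sum_div]
  congr 1
  · refine Finset.sum_congr rfl fun c _ => Finset.sum_congr rfl fun s _ => by ring
  · congr 1 <;>
    · refine Finset.sum_congr rfl fun c _ => Finset.sum_congr rfl fun s _ => by ring

variable [MeasurableSpace C] [MeasurableSpace S] [MeasurableSpace A]

/-- The true mean reward competes in the least-squares problem, so the estimate has nonpositive
excess loss, and the uniform concentration bound applies to it. -/
theorem Alg.sum_rewDev_le (𝒜 : Alg C S A H) (M : CMDP C S A H) {F : Finset (C → S → A → ℝ)}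
    (hH : 1 ≤ H) (hMF : M.meanRew ∈ F) (hFo : IsRewOracle F 𝒜.rewOracle) {T : ℕ}
    (σ : Fin T → Traj C S A H) {L : ℝ} (t : Fin T)
    (h : ∀ f ∈ F, (∑ i : Fin T, if (i : ℕ) < t then
        (M.rewDev f (𝒜.policy (initial σ i)) / (16 * H) - M.rewGap f (σ i) / (8 * H)) else 0) ≤ L) :
    ∑ i : Fin t, M.rewDev (𝒜.rewOracle t (initial σ t)) (𝒜.policy (initial (initial σ t) i)) ≤
      16 * H * L := by
  have hH' : (0 : ℝ) < H := by exact_mod_cast hH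
  obtain ⟨hmem, hmin⟩ := (hFo t).2 (initial σ t)
  have h1 := h _ hmem
  rw [sum_ite_lt_eq t.2.le (fun i => M.rewDev _ (𝒜.policy (initial σ i)) / (16 * H) -
    M.rewGap _ (σ i) / (8 * H)), Finset.sum_sub_distrib, ← Finset.sum_div, ← Finset.sum_div] at h1
  have h2 := hmin _ hMF
  rw [← sub_nonpos, rewLoss_sub_rewLoss] at h2
  have h3 : (∑ i : Fin t, M.rewGap (𝒜.rewOracle t (initial σ t)) (σ (Fin.castLE t.2.le i))) /
      (8 * H) ≤ 0 := div_nonpos_of_nonpos_of_nonneg h2 (by positivity)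
  have h4 : (∑ i : Fin t, M.rewDev (𝒜.rewOracle t (initial σ t))
      (𝒜.policy (initial (initial σ t) i))) / (16 * H) ≤ L := by
    refine le_trans (le_of_eq rfl) (le_trans (le_sub_self_iff _ |>.2 h3) h1)
  rwa [div_le_iff₀ (by positivity), mul_comm] at h4

theorem Alg.sum_dynDev_le (𝒜 : Alg C S A H) (M : CMDP C S A H)
    {Fp : Finset (C → S → A → S → ℝ)}
    (hH : 1 ≤ H) (hMP : M.dyn ∈ Fp) (hPo : IsDynOracle Fp 𝒜.dynOracle) {T : ℕ}
    (σ : Fin T → Traj C S A H) {L : ℝ} (t : Fin T)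
    (h : ∀ P ∈ Fp, (∑ i : Fin T, if (i : ℕ) < t then
      (M.dynDev P (𝒜.policy (initial σ i)) / (32 * H) - M.dynGap P (σ i) / (16 * H)) else 0) ≤ L) :
    ∑ i : Fin t, M.dynDev (𝒜.dynOracle t (initial σ t)) (𝒜.policy (initial (initial σ t) i)) ≤
      32 * H * L := by
  have hH' : (0 : ℝ) < H := by exact_mod_cast hH
  obtain ⟨hmem, hmin⟩ := (hPo t).2 (initial σ t)
  have h1 := h _ hmem
  rw [sum_ite_lt_eq t.2.le (fun i => M.dynDev _ (𝒜.policy (initial σ i)) / (32 * H) -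
    M.dynGap _ (σ i) / (16 * H)), Finset.sum_sub_distrib, ← Finset.sum_div, ← Finset.sum_div] at h1
  have h2 := hmin _ hMP
  rw [← sub_nonpos, dynLoss_sub_dynLoss] at h2
  have h3 : (∑ i : Fin t, M.dynGap (𝒜.dynOracle t (initial σ t)) (σ (Fin.castLE t.2.le i))) /
      (16 * H) ≤ 0 := div_nonpos_of_nonpos_of_nonneg h2 (by positivity)
  have h4 : (∑ i : Fin t, M.dynDev (𝒜.dynOracle t (initial σ t))
      (𝒜.policy (initial (initial σ t) i))) / (32 * H) ≤ L := by
    refine le_trans (le_of_eq rfl) (le_trans (le_sub_self_iff _ |>.2 h3) h1)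
  rwa [div_le_iff₀ (by positivity), mul_comm] at h4

/-- Sum of the expected regrets of the rounds on the event that the estimates concentrate. -/
theorem Alg.sum_meanRegret_le (𝒜 : Alg C S A H) (M : CMDP C S A H)
    {F : Finset (C → S → A → ℝ)} {Fp : Finset (C → S → A → S → ℝ)} [Nonempty A]
    {πs : C → S → A} {δ : ℝ} {T : ℕ} (hH : 1 ≤ H) (hp : 0 < 𝒜.pmin)
    (hreach : M.MinReach 𝒜.pmin)
    (hF : ∀ f ∈ F, ∀ c s a, f c s a ∈ Set.Icc (0 : ℝ) 1) (hMF : M.meanRew ∈ F)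
    (hP : ∀ P ∈ Fp, ∀ c, IsTransition (P c) ∧
      ∃ layer : S → Fin (H + 1), IsLayering M.s0 M.sH (P c) layer)
    (hMP : M.dyn ∈ Fp)
    (hFo : IsRewOracle F 𝒜.rewOracle) (hPo : IsDynOracle Fp 𝒜.dynOracle)
    (hplan : IsPlanner H M.s0 𝒜.plan) (hδ : 0 < δ) (hδ1 : δ < 1)
    (hβ : ∀ t, 𝒜.β t = betaParam F.card (Fintype.card S) (Fintype.card A) δ t)
    (hγ : ∀ t, 𝒜.γ t = gammaParam Fp.card (Fintype.card S) (Fintype.card A) δ t)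
    (hT : 1 ≤ T) (σ : Fin T → Traj C S A H)
    (hσF : ∀ n < T, ∀ f ∈ F, (∑ t : Fin T, if (t : ℕ) < n then
        (M.rewDev f (𝒜.policy (initial σ t)) / (16 * H) - M.rewGap f (σ t) / (8 * H)) else 0) ≤
          Real.log (3 * T * F.card / δ))
    (hσP : ∀ n < T, ∀ P ∈ Fp, (∑ t : Fin T, if (t : ℕ) < n then
        (M.dynDev P (𝒜.policy (initial σ t)) / (32 * H) - M.dynGap P (σ t) / (16 * H)) else 0) ≤
          Real.log (3 * T * Fp.card / δ)) :
    ∑ t : Fin T, M.meanRegret πs (𝒜.policy (initial σ t)) ≤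
      H * √(T * Fintype.card A) +
      20 * (1 + Real.log T) ^ 2 / 𝒜.pmin *
        (√(T * (Fintype.card S * Fintype.card A) * logp (F.card / δ)) +
          H * Fintype.card S * √(T * (Fintype.card S * Fintype.card A) * logp (Fp.card / δ))) +
      48 * (1 + Real.log T) * H * √(T * (Fintype.card S * Fintype.card A) * logp (F.card / δ)) +
      96 * (1 + Real.log T) * H ^ 2 *
        √(T * (Fintype.card S * Fintype.card A) * logp (Fp.card / δ)) := by
  have : Nonempty S := ⟨M.s0⟩
  have hH' : (1 : ℝ) ≤ H := by exact_mod_cast hH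
  have hcF : 1 ≤ F.card := Finset.card_pos.2 ⟨_, hMF⟩
  have hcP : 1 ≤ Fp.card := Finset.card_pos.2 ⟨_, hMP⟩
  have hT' : (1 : ℝ) ≤ T := by exact_mod_cast hT
  have hS : (0 : ℝ) < Fintype.card S := by exact_mod_cast Fintype.card_pos
  have hA : (0 : ℝ) < Fintype.card A := by exact_mod_cast Fintype.card_pos
  have hM := hF _ hMF
  set lF := logp (F.card / δ) with hlF
  set lP := logp (Fp.card / δ) with hlP
  have hlF1 : 1 ≤ lF := one_le_logp _
  have hlP1 : 1 ≤ lP := one_le_logp _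
  set a : ℝ := Fintype.card S * Fintype.card A with ha
  have ha0 : 0 < a := mul_pos hS hA
  set Λ := 1 + Real.log T with hΛ
  have hΛ1 : 1 ≤ Λ := by
    have := Real.log_natCast_nonneg T
    linarith
  have hLF : Real.log (3 * T * F.card / δ) ≤ 3 * Λ * lF := log_three_mul_div_le hcF hT hδ
  have hLP : Real.log (3 * T * Fp.card / δ) ≤ 3 * Λ * lP := log_three_mul_div_le hcP hT hδ
  have hβb : ∀ t : Fin T, √(((t : ℕ) + 1 : ℝ) * lF / a) ≤ 𝒜.β (t + 1) ∧
      𝒜.β (t + 1) ≤ 10 * Λ * √(T * lF / a) := by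
    intro t
    have := sqrt_param_bounds (κ := 17) hcF (Nat.le_add_left 1 t) t.2 hδ hδ1 ha0 (by norm_num)
      (by norm_num)
    rw [hβ, betaParam]
    push_cast at this ⊢
    exact this
  have hγb : ∀ t : Fin T, √(((t : ℕ) + 1 : ℝ) * lP / a) ≤ 𝒜.γ (t + 1) ∧
      𝒜.γ (t + 1) ≤ 10 * Λ * √(T * lP / a) := by
    intro t
    have := sqrt_param_bounds (κ := 18) hcP (Nat.le_add_left 1 t) t.2 hδ hδ1 ha0 (by norm_num)
      (by norm_num)
    rw [hγ, gammaParam]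
    push_cast at this ⊢
    exact this
  set B := 10 * Λ * √(T * lF / a) + H * Fintype.card S * (10 * Λ * √(T * lP / a)) with hB
  let cnt : Fin T → ℝ := fun t => ∑ c, M.wt c *
      ∑ s, (𝒜.count (initial σ t) c s (𝒜.policy (initial σ t) c s))⁻¹
  have hcnt : ∀ t, 0 ≤ cnt t := by
    intro t
    refine Finset.sum_nonneg fun c _ => mul_nonneg (M.wt_nonneg c) (Finset.sum_nonneg fun s _ => ?_)
    refine inv_nonneg.2 (Finset.sum_nonneg fun i _ => ?_)
    split_ifs <;> norm_num
  -- The initial rounds are charged `H` each. Later, `2 · 16 · 3 / 4 = 24` and `2 · 32 · 3 / 4 = 48`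
  -- come from the concentration constants, the bound `3 Λ lF` or `3 Λ lP` for the logarithm, and
  -- the `4β`, `4γ` of AM-GM.
  have hround : ∀ t : Fin T, M.meanRegret πs (𝒜.policy (initial σ t)) ≤
      (if (t : ℕ) < min T (Fintype.card A) then (H : ℝ) else 0) + 2 * B / 𝒜.pmin * cnt t +
        24 * Λ * H * √(a * lF) * (√((t : ℕ) + 1 : ℝ))⁻¹ +
        48 * Λ * H ^ 2 * √(a * lP) * (√((t : ℕ) + 1 : ℝ))⁻¹ := by
    intro t
    have n1 : 0 ≤ 2 * B / 𝒜.pmin * cnt t := mul_nonneg (by positivity) (hcnt t)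
    by_cases ht : (t : ℕ) < Fintype.card A
    · rw [if_pos (lt_min t.2 ht)]
      have h1 : M.meanRegret πs (𝒜.policy (initial σ t)) ≤ H := by
        calc M.meanRegret πs (𝒜.policy (initial σ t)) ≤ ∑ c, M.wt c * (H : ℝ) := by
              refine Finset.sum_le_sum fun c _ => mul_le_mul_of_nonneg_left ?_ (M.wt_nonneg c)
              have h1 : M.val c (πs c) ≤ H :=
                value_le H M.s0 (M.isTransition c) (fun s a => (hM c s a).2) _
              have h2 : 0 ≤ M.val c (𝒜.policy (initial σ t) c) :=
                value_nonneg H M.s0 (M.isTransition c) (fun s a => (hM c s a).1) _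
              linarith
          _ = H := by rw [← Finset.sum_mul, M.sum_wt, one_mul]
      have n2 : 0 ≤ 24 * Λ * H * √(a * lF) * (√((t : ℕ) + 1 : ℝ))⁻¹ := by positivity
      have n3 : 0 ≤ 48 * Λ * H ^ 2 * √(a * lP) * (√((t : ℕ) + 1 : ℝ))⁻¹ := by positivity
      linarith
    · rw [if_neg (fun h => ht (h.trans_le (min_le_right _ _)))]
      have ht1 : (0 : ℝ) < (t : ℕ) + 1 := by positivity
      have hβ0 : 0 < √(((t : ℕ) + 1 : ℝ) * lF / a) := Real.sqrt_pos.2 (by positivity)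
      have hγ0 : 0 < √(((t : ℕ) + 1 : ℝ) * lP / a) := Real.sqrt_pos.2 (by positivity)
      have hβ1 := hβ0.trans_le (hβb t).1
      have hγ1 := hγ0.trans_le (hγb t).1
      have h1 := 𝒜.meanRegret_le M hp hreach hM hplan (initial σ t) (not_lt.1 ht)
        (hP _ ((hPo t).2 _).1) hβ1 hγ1 πs
      have h2 : 2 * ((𝒜.β (t + 1) + H * Fintype.card S * 𝒜.γ (t + 1)) / 𝒜.pmin * cnt t) ≤
          2 * B / 𝒜.pmin * cnt t := by
        have hb : 𝒜.β (t + 1) + H * Fintype.card S * 𝒜.γ (t + 1) ≤ B :=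
          add_le_add (hβb t).2 (mul_le_mul_of_nonneg_left (hγb t).2 (by positivity))
        rw [mul_div_assoc, mul_assoc 2 (B / 𝒜.pmin)]
        exact mul_le_mul_of_nonneg_left (mul_le_mul_of_nonneg_right
          (div_le_div_of_nonneg_right hb hp.le) (hcnt t)) two_pos.le
      have h3 : (∑ i : Fin t, M.rewDev (𝒜.rewOracle t (initial σ t))
          (𝒜.policy (initial (initial σ t) i))) / (4 * 𝒜.β (t + 1)) ≤
          12 * Λ * H * √(a * lF) * (√((t : ℕ) + 1 : ℝ))⁻¹ := by
        have e := 𝒜.sum_rewDev_le M hH hMF hFo σ t (hσF t t.2)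
        calc _ ≤ 16 * H * (3 * Λ * lF) / (4 * √(((t : ℕ) + 1 : ℝ) * lF / a)) := by
              refine div_le_div₀ (by positivity) (e.trans ?_) (by positivity) ?_
              · exact mul_le_mul_of_nonneg_left hLF (by positivity)
              · exact mul_le_mul_of_nonneg_left (hβb t).1 (by norm_num)
          _ = 12 * Λ * H * (lF / √(((t : ℕ) + 1 : ℝ) * lF / a)) := by ring
          _ = _ := by rw [div_sqrt_mul_div (by linarith) ht1 ha0]; ring
      have h4 : H * (∑ i : Fin t, M.dynDev (𝒜.dynOracle t (initial σ t))
          (𝒜.policy (initial (initial σ t) i))) / (4 * 𝒜.γ (t + 1)) ≤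
          24 * Λ * H ^ 2 * √(a * lP) * (√((t : ℕ) + 1 : ℝ))⁻¹ := by
        have e := 𝒜.sum_dynDev_le M hH hMP hPo σ t (hσP t t.2)
        calc _ ≤ H * (32 * H * (3 * Λ * lP)) / (4 * √(((t : ℕ) + 1 : ℝ) * lP / a)) := by
              refine div_le_div₀ (by positivity) (mul_le_mul_of_nonneg_left (e.trans ?_)
                (by positivity)) (by positivity) ?_
              · exact mul_le_mul_of_nonneg_left hLP (by positivity)
              · exact mul_le_mul_of_nonneg_left (hγb t).1 (by norm_num)
          _ = 24 * Λ * H ^ 2 * (lP / √(((t : ℕ) + 1 : ℝ) * lP / a)) := by ring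
          _ = _ := by rw [div_sqrt_mul_div (by linarith) ht1 ha0]; ring
      simp only [cnt] at h2 ⊢
      linarith
  refine (Finset.sum_le_sum fun t _ => hround t).trans ?_
  simp only [Finset.sum_add_distrib, ← Finset.mul_sum]
  -- Using `min T |A| ≤ √(T|A|)` absorbs the initial phase, so that no additive `|A|H` remains; the
  -- last bound of the theorem requires this.
  have s1 : (∑ t : Fin T, if (t : ℕ) < min T (Fintype.card A) then (H : ℝ) else 0) ≤
      H * √(T * Fintype.card A) := by
    rw [sum_ite_lt_eq (min_le_left _ _) (fun _ => (H : ℝ)), Finset.sum_const, Finset.card_univ,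
      Fintype.card_fin, nsmul_eq_mul, mul_comm]
    refine mul_le_mul_of_nonneg_left (Real.le_sqrt_of_sq_le ?_) (by positivity)
    rw [sq]
    exact mul_le_mul (by exact_mod_cast min_le_left _ _) (by exact_mod_cast min_le_right _ _)
      (by positivity) (by positivity)
  have hsa : ∀ l : ℝ, 0 ≤ l → √(T * l / a) * a = √(T * a * l) := by
    intro l hl
    rw [show T * a * l = T * l / a * a ^ 2 by field_simp,
      Real.sqrt_mul (by positivity), Real.sqrt_sq ha0.le]
  have s2 : 2 * B / 𝒜.pmin * ∑ t, cnt t ≤ 20 * Λ ^ 2 / 𝒜.pmin *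
      (√(T * a * lF) + H * Fintype.card S * √(T * a * lP)) := by
    have h1 := 𝒜.sum_count_inv_le M hT σ
    calc 2 * B / 𝒜.pmin * ∑ t, cnt t ≤ 2 * B / 𝒜.pmin * (a * Λ) := by
          refine mul_le_mul_of_nonneg_left (h1.trans (le_of_eq ?_)) (by positivity)
          rw [ha, mul_assoc]
      _ = 20 * Λ ^ 2 / 𝒜.pmin * (√(T * lF / a) * a + H * Fintype.card S *
          (√(T * lP / a) * a)) := by rw [hB]; ring
      _ = _ := by rw [hsa lF (by linarith), hsa lP (by linarith)]
  have hst : ∀ l : ℝ, 0 ≤ l → √(a * l) * √T = √(T * a * l) := by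
    intro l hl
    rw [← Real.sqrt_mul (by positivity)]
    congr 1
    ring
  have s3 := mul_le_mul_of_nonneg_left (sum_inv_sqrt_le T)
    (by positivity : 0 ≤ 24 * Λ * H * √(a * lF))
  have s4 := mul_le_mul_of_nonneg_left (sum_inv_sqrt_le T)
    (by positivity : 0 ≤ 48 * Λ * H ^ 2 * √(a * lP))
  have e3 : 24 * Λ * H * √(a * lF) * (2 * √T) = 48 * Λ * H * √(T * a * lF) := by
    rw [← hst lF (by linarith)]; ring
  have e4 : 48 * Λ * H ^ 2 * √(a * lP) * (2 * √T) = 96 * Λ * H ^ 2 * √(T * a * lP) := by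
    rw [← hst lP (by linarith)]; ring
  rw [e3] at s3
  rw [e4] at s4
  linarith

end Sum

/-! ### Assembling the regret bound -/

section Final

theorem rpow_three_halves_mul_sqrt {x : ℝ} (hx : 0 < x) (y : ℝ) :
    x ^ (3 / 2 : ℝ) * √y = x * √(x * y) := by
  rw [show (3 / 2 : ℝ) = 1 + 1 / 2 by norm_num, Real.rpow_add hx, Real.rpow_one,
    ← Real.sqrt_eq_rpow, Real.sqrt_mul hx.le, mul_assoc]

/-- The deviation term `Hℓ` is replaced by `H√(Tℓ)`: if `ℓ ≤ T` then `ℓ ≤ √(Tℓ)`, otherwise the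
trivial bound `R ≤ HT` suffices. Every term then fits under the main one; the coefficient of `H X`
is `2(1 + 96) + 2 = 196`, rounded to `200`. -/
theorem regret_arith {R Sm H T Λ p lP nS nA RF ℓ : ℝ} (hH : 1 ≤ H) (hT : 1 ≤ T) (hΛ : 1 ≤ Λ)
    (hp : 0 < p) (hlP : 1 ≤ lP) (hS : 1 ≤ nS) (hA : 1 ≤ nA) (hRF : 0 ≤ RF) (hℓ : 0 ≤ ℓ)
    (hℓP : ℓ ≤ 3 * lP) (hRT : R ≤ H * T) (hR : R / H - 2 * Sm / H ≤ ℓ) (hSm : 0 ≤ Sm)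
    (hSmle : Sm ≤ H * √(T * nA) + 20 * Λ ^ 2 / p * (RF + H * nS * √(T * (nS * nA) * lP)) +
      48 * Λ * H * RF + 96 * Λ * H ^ 2 * √(T * (nS * nA) * lP)) :
    R ≤ 200 * Λ ^ 2 * ((H + 1 / p) * (H * (nS * √(T * (nS * nA) * lP)) + RF)) := by
  have hR1 : R ≤ 2 * Sm + H * ℓ := by
    rw [← sub_div, div_le_iff₀ (by linarith)] at hR
    linarith
  have hR2 : R ≤ 2 * Sm + H * √(T * ℓ) := by
    rcases le_total ℓ T with h | h
    · refine hR1.trans ?_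
      gcongr
      exact Real.le_sqrt_of_sq_le (by nlinarith)
    · have : T ≤ √(T * ℓ) := Real.le_sqrt_of_sq_le (by nlinarith)
      nlinarith
  set r := √(T * (nS * nA) * lP) with hr
  have hr0 : 0 ≤ r := Real.sqrt_nonneg _
  have hSA : 1 ≤ nS * nA := by nlinarith
  have h1 : √(T * ℓ) ≤ 2 * r := by
    rw [Real.sqrt_le_left (by positivity), mul_pow, hr, Real.sq_sqrt (by positivity)]
    calc T * ℓ ≤ T * (3 * lP) := by gcongr
      _ ≤ 2 ^ 2 * (T * 1 * lP) := by
        nlinarith [mul_pos (by linarith : 0 < T) (by linarith : 0 < lP)]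
      _ ≤ 2 ^ 2 * (T * (nS * nA) * lP) := by gcongr
  have h2 : √(T * nA) ≤ r := by
    refine Real.sqrt_le_sqrt ?_
    calc T * nA ≤ T * (nS * nA) := by gcongr; nlinarith
      _ ≤ T * (nS * nA) * lP := le_mul_of_one_le_right (by positivity) hlP
  set Q := nS * r with hQ
  have hrQ : r ≤ Q := le_mul_of_one_le_left hr0 hS
  have hQ0 : 0 ≤ Q := hr0.trans hrQ
  have hΛ2 : Λ ≤ Λ ^ 2 := by nlinarith
  have hΛ3 : 1 ≤ Λ ^ 2 := by nlinarith
  set X := H * Q + RF with hX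
  have hHQ : 0 ≤ H * Q := by positivity
  have hX0 : 0 ≤ X := by positivity
  have hHX : 0 ≤ H * X := by positivity
  have hQX : H * Q ≤ H * X := by nlinarith
  have t1 : H * √(T * nA) ≤ Λ ^ 2 * (H * X) := by
    calc H * √(T * nA) ≤ H * Q := by gcongr; exact h2.trans hrQ
      _ ≤ H * X := hQX
      _ ≤ Λ ^ 2 * (H * X) := le_mul_of_one_le_left hHX hΛ3
  have t2 : 48 * Λ * H * RF + 96 * Λ * H ^ 2 * r ≤ 96 * (Λ ^ 2 * (H * X)) := by
    calc 48 * Λ * H * RF + 96 * Λ * H ^ 2 * r ≤ 96 * Λ * H * RF + 96 * Λ * H ^ 2 * Q := by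
          gcongr
          norm_num
      _ = 96 * (Λ * (H * X)) := by rw [hX]; ring
      _ ≤ 96 * (Λ ^ 2 * (H * X)) := by gcongr
  have t3 : 20 * Λ ^ 2 / p * (RF + H * nS * r) = 20 * (Λ ^ 2 * (1 / p * X)) := by
    rw [hX, hQ]
    ring
  have t4 : H * √(T * ℓ) ≤ 2 * (Λ ^ 2 * (H * X)) := by
    calc H * √(T * ℓ) ≤ H * (2 * Q) := by gcongr; linarith
      _ = 2 * (H * Q) := by ring
      _ ≤ 2 * (Λ ^ 2 * (H * X)) := mul_le_mul_of_nonneg_left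
        (hQX.trans (le_mul_of_one_le_left hHX hΛ3)) two_pos.le
  have t5 : 0 ≤ Λ ^ 2 * (1 / p * X) := by positivity
  have t6 : 0 ≤ Λ ^ 2 * (H * X) := by positivity
  have t7 : 200 * Λ ^ 2 * ((H + 1 / p) * X) =
      200 * (Λ ^ 2 * (H * X)) + 200 * (Λ ^ 2 * (1 / p * X)) := by ring
  rw [t7]
  rw [t3] at hSmle
  linarith

theorem Alg.regret_eq_zero_of_horizon_eq_zero {C S A : Type*} [Fintype S] [Fintype A]
    [DecidableEq S] [DecidableEq A] {H : ℕ} (𝒜 : Alg C S A H) (M : CMDP C S A H)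
    (πs : C → S → A) (hH : H = 0) {T : ℕ} (σ : Fin T → Traj C S A H) : 𝒜.regret M πs σ = 0 := by
  subst hH
  simp [Alg.regret, CMDP.val, value_zero]

theorem card_le_pow_of_forall_mem {C S A : Type*} [Fintype S]
    {F : Finset (C → S → A → ℝ)} {G : Finset (C → A → ℝ)}
    (h : ∀ f ∈ F, ∀ s, (fun c a => f c s a) ∈ G) : F.card ≤ G.card ^ Fintype.card S := by
  classical
  have : F.card ≤ (Fintype.piFinset fun _ : S => G).card := by
    refine Finset.card_le_card_of_injOn (fun f s c a => f c s a)
      (fun f hf => Fintype.mem_piFinset.2 fun s => h f hf s) fun f _ g _ hfg => ?_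
    funext c s a
    exact congrFun (congrFun (congrFun hfg s) c) a
  simpa using this

theorem logp_card_le {N G n : ℕ} (hN : 1 ≤ N) (hn : 1 ≤ n) (h : N ≤ G ^ n) {δ : ℝ} (hδ : 0 < δ)
    (hδ1 : δ < 1) : logp (N / δ) ≤ n * logp (G / δ) := by
  have hn' : (1 : ℝ) ≤ n := by exact_mod_cast hn
  have hG : 1 ≤ G := by
    by_contra hG
    obtain rfl : G = 0 := by omega
    rw [zero_pow (by omega)] at h
    omega
  have hG' : (0 : ℝ) < G := by exact_mod_cast hG
  have hN' : (0 : ℝ) < N := by exact_mod_cast hN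
  have h1 := one_le_logp (G / δ)
  refine max_le (by nlinarith) ?_
  -- Since `δ < 1`, `δ ^ n ≤ δ`: raising the confidence to the power `n` only helps.
  have h2 : (N : ℝ) / δ ≤ (G / δ) ^ n := by
    rw [div_pow]
    have : (N : ℝ) ≤ (G : ℝ) ^ n := by exact_mod_cast h
    have h3 : δ ^ n ≤ δ := pow_le_of_le_one hδ.le hδ1.le (by omega)
    gcongr
  refine (Real.log_le_log (by positivity) h2).trans ?_
  rw [Real.log_pow]
  exact mul_le_mul_of_nonneg_left (log_le_logp _) (by linarith)

variable {C S A : Type*} [Fintype C] [Fintype S] [Fintype A] [Nonempty A]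
  [DecidableEq S] [DecidableEq A]
  [MeasurableSpace C] [MeasurableSingletonClass C]
  [MeasurableSpace S] [MeasurableSingletonClass S]
  [MeasurableSpace A] [MeasurableSingletonClass A] {H : ℕ}

/-- High-probability regret bound in terms of the sizes of the two classes. -/
theorem Alg.le_historyLaw_regret (𝒜 : Alg C S A H) (M : CMDP C S A H)
    {F : Finset (C → S → A → ℝ)} {Fp : Finset (C → S → A → S → ℝ)}
    {πs : C → S → A} {δ : ℝ} {T : ℕ} (hp : 0 < 𝒜.pmin) (hreach : M.MinReach 𝒜.pmin)
    (hF : ∀ f ∈ F, ∀ c s a, f c s a ∈ Set.Icc (0 : ℝ) 1) (hMF : M.meanRew ∈ F)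
    (hP : ∀ P ∈ Fp, ∀ c, IsTransition (P c) ∧
      ∃ layer : S → Fin (H + 1), IsLayering M.s0 M.sH (P c) layer)
    (hMP : M.dyn ∈ Fp)
    (hFo : IsRewOracle F 𝒜.rewOracle) (hPo : IsDynOracle Fp 𝒜.dynOracle)
    (hplan : IsPlanner H M.s0 𝒜.plan) (hδ : 0 < δ) (hδ1 : δ < 1)
    (hβ : ∀ t, 𝒜.β t = betaParam F.card (Fintype.card S) (Fintype.card A) δ t)
    (hγ : ∀ t, 𝒜.γ t = gammaParam Fp.card (Fintype.card S) (Fintype.card A) δ t)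
    (hπs : M.IsOptimal πs) (hT : 1 ≤ T) (hH : 1 ≤ H) :
    ENNReal.ofReal (1 - δ) ≤ 𝒜.historyLaw M T {σ | 𝒜.regret M πs σ ≤
      200 * (1 + Real.log T) ^ 2 * ((H + 1 / 𝒜.pmin) *
        (H * ((Fintype.card S : ℝ) ^ (3 / 2 : ℝ) *
            √(Fintype.card A * T * logp (Fp.card / δ)))
          + √(T * Fintype.card S * Fintype.card A * logp (F.card / δ))))} := by
  have : Nonempty S := ⟨M.s0⟩
  have hS : (1 : ℝ) ≤ Fintype.card S := by exact_mod_cast Fintype.card_pos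
  have hA : (1 : ℝ) ≤ Fintype.card A := by exact_mod_cast Fintype.card_pos
  have hM := hF _ hMF
  refine (𝒜.le_historyLaw_concentration M hH hF hMF (fun P h c => (hP P h c).1) hMP hFo hPo hδ hπs
    hT).trans (measure_mono fun σ hσ => ?_)
  obtain ⟨hσF, hσP, hσR⟩ := hσ
  have hsum := 𝒜.sum_meanRegret_le M (πs := πs) hH hp hreach hF hMF hP hMP hFo hPo hplan hδ hδ1 hβ
    hγ hT σ hσF hσP
  have hlog := Real.log_natCast_nonneg T
  have hlP := one_le_logp (Fp.card / δ)
  have hRT : 𝒜.regret M πs σ ≤ H * T := by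
    calc 𝒜.regret M πs σ ≤ ∑ _t : Fin T, (H : ℝ) := by
          refine Finset.sum_le_sum fun t _ => ?_
          have h1 : M.val (σ t).1 (πs (σ t).1) ≤ H :=
            value_le H M.s0 (M.isTransition _) (fun s a => (hM _ s a).2) _
          have h2 : 0 ≤ M.val (σ t).1 (𝒜.policy (initial σ t) (σ t).1) :=
            value_nonneg H M.s0 (M.isTransition _) (fun s a => (hM _ s a).1) _
          exact (sub_le_self _ h2).trans h1
      _ = H * T := by simp [mul_comm]
  have hSm : 0 ≤ ∑ t : Fin T, M.meanRegret πs (𝒜.policy (initial σ t)) :=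
    Finset.sum_nonneg fun t _ => Finset.sum_nonneg fun c _ =>
      mul_nonneg (M.wt_nonneg c) (sub_nonneg.2 (hπs c _))
  have key := regret_arith (by exact_mod_cast hH) (by exact_mod_cast hT) (by linarith) hp hlP hS hA
    (Real.sqrt_nonneg _) (Real.log_nonneg (by rw [le_div_iff₀ hδ]; linarith))
    (log_three_div_le (Finset.card_pos.2 ⟨_, hMP⟩) hδ) hRT hσR hSm hsum
  refine key.trans (le_of_eq ?_)
  rw [rpow_three_halves_mul_sqrt (by linarith), ← mul_assoc (T : ℝ) (Fintype.card S : ℝ),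
    show (Fintype.card S : ℝ) * (Fintype.card A * T * logp (Fp.card / δ)) =
      T * Fintype.card S * Fintype.card A * logp (Fp.card / δ) by ring]

end Final

end UCDD

end

/-! ### The theorem -/

theorem mainTheorem3 :
    ∃ (K : ℝ) (k : ℕ), 0 < K ∧
      ∀ (C S A : Type*) [Fintype C] [Fintype S] [Fintype A] [Nonempty A]
        [DecidableEq S] [DecidableEq A]
        [MeasurableSpace C] [MeasurableSingletonClass C]
        [MeasurableSpace S] [MeasurableSingletonClass S]
        [MeasurableSpace A] [MeasurableSingletonClass A]
        (H : ℕ) (M : UCDD.CMDP C S A H)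
        (F : Finset (C → S → A → ℝ)) (Fp : Finset (C → S → A → S → ℝ))
        (𝒜 : UCDD.Alg C S A H) (πs : C → S → A) (δ : ℝ) (T : ℕ),
        -- minimum reachability, with a parameter known to the algorithm
        0 < 𝒜.pmin → 𝒜.pmin ≤ 1 → M.MinReach 𝒜.pmin →
        -- the reward class: functions into [0,1], realizable
        (∀ f ∈ F, ∀ c s a, f c s a ∈ Set.Icc (0 : ℝ) 1) → M.meanRew ∈ F →
        -- the dynamics class: layered dynamics for every context, realizable
        (∀ P ∈ Fp, ∀ c, UCDD.IsTransition (P c) ∧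
          ∃ layer : S → Fin (H + 1), UCDD.IsLayering M.s0 M.sH (P c) layer) →
        M.dyn ∈ Fp →
        -- the oracles, the planner and the tuning parameters
        UCDD.IsRewOracle F 𝒜.rewOracle → UCDD.IsDynOracle Fp 𝒜.dynOracle →
        UCDD.IsPlanner H M.s0 𝒜.plan →
        0 < δ → δ < 1 →
        (∀ t, 𝒜.β t = UCDD.betaParam F.card (Fintype.card S) (Fintype.card A) δ t) →
        (∀ t, 𝒜.γ t = UCDD.gammaParam Fp.card (Fintype.card S) (Fintype.card A) δ t) →
        M.IsOptimal πs → 1 ≤ T →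
        -- the bound in terms of F and Fp
        ENNReal.ofReal (1 - δ) ≤ 𝒜.historyLaw M T {σ | 𝒜.regret M πs σ ≤
          K * (1 + Real.log T) ^ k *
            ((H + 1 / 𝒜.pmin) *
              (H * (Fintype.card S : ℝ) ^ (3 / 2 : ℝ) *
                  √(Fintype.card A * T * UCDD.logp (Fp.card / δ))
                + √(T * Fintype.card S * Fintype.card A * UCDD.logp (F.card / δ)))
              + Fintype.card A * H)} ∧
        -- the bounds in terms of G, where F = G^S
        ∀ G : Finset (C → A → ℝ), (∀ f, f ∈ F ↔ ∀ s, (fun c a => f c s a) ∈ G) →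
          ENNReal.ofReal (1 - δ) ≤ 𝒜.historyLaw M T {σ | 𝒜.regret M πs σ ≤
            K * (1 + Real.log T) ^ k *
              ((H + 1 / 𝒜.pmin) *
                (H * (Fintype.card S : ℝ) ^ (3 / 2 : ℝ) *
                    √(T * Fintype.card A * UCDD.logp (Fp.card / δ))
                  + Fintype.card S * √(T * Fintype.card A * UCDD.logp (G.card / δ)))
                + Fintype.card A * H)} ∧
          ENNReal.ofReal (1 - δ) ≤ 𝒜.historyLaw M T {σ | 𝒜.regret M πs σ ≤
            K * (1 + Real.log T) ^ k *
              ((H + 1 / 𝒜.pmin) * (H * (Fintype.card S : ℝ) ^ (3 / 2 : ℝ) *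
                √(Fintype.card A * T * UCDD.logp ((max G.card Fp.card : ℕ) / δ))))} := by
  -- `400 = 2 · 200`; the extra `2` absorbs the two summands into one in the last bound.
  refine ⟨400, 2, by norm_num, ?_⟩
  intro C S A _ _ _ _ _ _ _ _ _ _ _ _ H M F Fp 𝒜 πs δ T hp hp1 hreach hF hMF hP hMP hFo hPo
    hplan hδ hδ1 hβ hγ hπs hT
  have : Nonempty S := ⟨M.s0⟩
  have hS : (1 : ℝ) ≤ Fintype.card S := by exact_mod_cast Fintype.card_pos
  have hlog := Real.log_natCast_nonneg T
  have hcF : 1 ≤ F.card := Finset.card_pos.2 ⟨_, hMF⟩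
  have hcP : 1 ≤ Fp.card := Finset.card_pos.2 ⟨_, hMP⟩
  have hlF := UCDD.one_le_logp (F.card / δ)
  have hlP := UCDD.one_le_logp (Fp.card / δ)
  have huniv := 𝒜.historyLaw_univ M (𝒜.measurable_policy hFo hPo) T
  -- It suffices to dominate the bound in terms of the classes when `1 ≤ H`.
  have reduce : ∀ {B : ℝ}, 0 ≤ B →
      (1 ≤ H → (H : ℝ) * ((Fintype.card S : ℝ) ^ (3 / 2 : ℝ) *
            √(Fintype.card A * T * UCDD.logp (Fp.card / δ)))
          + √(T * Fintype.card S * Fintype.card A * UCDD.logp (F.card / δ)) ≤ 2 * B) →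
      ∀ {B' : ℝ}, (H + 1 / 𝒜.pmin) * B ≤ B' →
      ENNReal.ofReal (1 - δ) ≤ 𝒜.historyLaw M T {σ | 𝒜.regret M πs σ ≤
        400 * (1 + Real.log T) ^ 2 * B'} := by
    intro B hB0 hB B' hB'
    have hB'0 : 0 ≤ B' := le_trans (by positivity) hB'
    -- The concentration argument divides by `H`; for `H = 0` the regret vanishes.
    rcases Nat.eq_zero_or_pos H with hH | hH
    · have : {σ : Fin T → UCDD.Traj C S A H | 𝒜.regret M πs σ ≤
          400 * (1 + Real.log T) ^ 2 * B'} = Set.univ := by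
        refine Set.eq_univ_of_forall fun σ => ?_
        rw [Set.mem_ofPred_eq, 𝒜.regret_eq_zero_of_horizon_eq_zero M πs hH]
        positivity
      rw [this, huniv, ← ENNReal.ofReal_one]
      exact ENNReal.ofReal_le_ofReal (by linarith)
    · refine (𝒜.le_historyLaw_regret M hp hreach hF hMF hP hMP hFo hPo hplan hδ hδ1 hβ hγ hπs hT
        hH).trans (measure_mono fun σ hσ => Set.mem_ofPred.2
        (le_trans (Set.mem_ofPred.1 hσ) ?_))
      have h1 := mul_le_mul_of_nonneg_left (hB hH) (by positivity : 0 ≤ (H : ℝ) + 1 / 𝒜.pmin)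
      have h2 := mul_le_mul_of_nonneg_left (h1.trans
        (by linarith : (H + 1 / 𝒜.pmin) * (2 * B) ≤ 2 * B'))
        (by positivity : 0 ≤ 200 * (1 + Real.log T) ^ 2)
      linarith
  refine ⟨?_, fun G hG => ?_⟩
  · refine reduce (B := H * (Fintype.card S : ℝ) ^ (3 / 2 : ℝ) *
        √(Fintype.card A * T * UCDD.logp (Fp.card / δ))
        + √(T * Fintype.card S * Fintype.card A * UCDD.logp (F.card / δ))) (by positivity)
      (fun _ => ?_) (le_add_of_nonneg_right (by positivity))
    rw [← mul_assoc]
    refine le_mul_of_one_le_left (by positivity) (by norm_num)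
  have hFG := UCDD.logp_card_le hcF Fintype.card_pos
    (UCDD.card_le_pow_of_forall_mem fun f hf s => (hG f).1 hf s) hδ hδ1
  have hlG := UCDD.one_le_logp (G.card / δ)
  have hsqrt : √(T * Fintype.card S * Fintype.card A * UCDD.logp (F.card / δ)) ≤
      Fintype.card S * √(T * Fintype.card A * UCDD.logp (G.card / δ)) := by
    rw [Real.sqrt_le_left (by positivity), mul_pow, Real.sq_sqrt (by positivity)]
    calc (T : ℝ) * Fintype.card S * Fintype.card A * UCDD.logp (F.card / δ)
        ≤ T * Fintype.card S * Fintype.card A * (Fintype.card S * UCDD.logp (G.card / δ)) := by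
          gcongr
      _ = _ := by ring
  constructor
  · refine reduce (B := H * (Fintype.card S : ℝ) ^ (3 / 2 : ℝ) *
        √(T * Fintype.card A * UCDD.logp (Fp.card / δ))
        + Fintype.card S * √(T * Fintype.card A * UCDD.logp (G.card / δ))) (by positivity)
      (fun _ => ?_) (le_add_of_nonneg_right (by positivity))
    rw [← mul_assoc, mul_comm (Fintype.card A : ℝ) (T : ℝ)]
    refine (add_le_add_right hsqrt _).trans ?_
    refine le_mul_of_one_le_left (by positivity) (by norm_num)
  · have hm := UCDD.one_le_logp (((max G.card Fp.card : ℕ) : ℝ) / δ)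
    refine reduce (B := H * (Fintype.card S : ℝ) ^ (3 / 2 : ℝ) *
        √(Fintype.card A * T * UCDD.logp ((max G.card Fp.card : ℕ) / δ))) (by positivity)
      (fun hH => ?_) le_rfl
    have hH' : (1 : ℝ) ≤ H := by exact_mod_cast hH
    have hcG : 0 < G.card := Finset.card_pos.2
      ⟨_, (hG _).1 hMF M.s0⟩
    have hPm : UCDD.logp (Fp.card / δ) ≤ UCDD.logp ((max G.card Fp.card : ℕ) / δ) := by
      refine UCDD.logp_le_logp (by positivity) ?_
      gcongr
      exact le_max_right _ _
    have hGm : UCDD.logp (G.card / δ) ≤ UCDD.logp ((max G.card Fp.card : ℕ) / δ) := by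
      refine UCDD.logp_le_logp (by positivity) ?_
      gcongr
      exact le_max_left _ _
    have h32 : (Fintype.card S : ℝ) ≤ (Fintype.card S : ℝ) ^ (3 / 2 : ℝ) :=
      Real.self_le_rpow_of_one_le hS (by norm_num)
    rw [← mul_assoc, two_mul]
    -- Each summand is at most `B`; for the reward part, `|S| ≤ |S|^(3/2)` and `1 ≤ H` are used.
    refine add_le_add (by gcongr) (hsqrt.trans ?_)
    calc (Fintype.card S : ℝ) * √(T * Fintype.card A * UCDD.logp (G.card / δ))
        ≤ (Fintype.card S : ℝ) ^ (3 / 2 : ℝ) *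
          √(T * Fintype.card A * UCDD.logp ((max G.card Fp.card : ℕ) / δ)) := by gcongr
      _ ≤ H * ((Fintype.card S : ℝ) ^ (3 / 2 : ℝ) *
          √(T * Fintype.card A * UCDD.logp ((max G.card Fp.card : ℕ) / δ))) :=
          le_mul_of_one_le_left (by positivity) hH'
      _ = _ := by rw [← mul_assoc, mul_comm (Fintype.card A : ℝ) (T : ℝ)]
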